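/- Let $(\Omega,\mathcal F,\nu)$ be a probability space, let $f(u)=u^3-u$, and consider the nonlocal equation $$\partial_t u(x,t)=-f(u(x,t))+\int_\Omega f(u(y,t))\,d\nu(y),\qquad x\in\Omega,\ t\ge 0, \tag{1}$$ for solutions with values in the bounded measurable functions on $\Omega$ (the equation holding for every $x\in\Omega$ and $t\ge0$, with $u$ bounded on $\Omega\times[0,T]$ for each $T$). Let the phase intervals be $$\Phi_l=\left[-\tfrac{2}{\sqrt3},-\tfrac1{\sqrt3}\right],\quad \Phi_m=\left(-\tfrac1{\sqrt3},\tfrac1{\sqrt3}\right),\quad \Phi_r=\left[\tfrac1{\sqrt3},\tfrac2{\sqrt3}\right].$$ The phase transition time of a point $x$ is the (unique, if it exists) $\tau\in(0,\infty]$ such that $u(x,t)\in\Phi_m$ for $0\le t<\tau$ and $u(x,t)\in\Phi_l\cup\Phi_r$ for $t\ge\tau$. Let $0<\eta\le\frac18$, $0<\mu_0\le\frac1{10}$, $0\le\theta\le\eta^2$, and $\mu_j=\mu_0\eta^j$ for $j\ge0$. Let $(\alpha_j)_{j\ge0}$ be a positive decreasing sequence with $\alpha_0\le\frac12$, and put $\alpha_{-1}=\alpha_{-2}=1$.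 Suppose that $\Omega$ is the disjoint union of measurable sets $\Omega_l,\Omega_m,\Omega_r,\Omega_0,\Omega_1,\Omega_2,\dots$ with $$\nu(\Omega_l)=\tfrac13-\sum_{j\text{ odd}}\mu_j,\quad \nu(\Omega_m)=\tfrac13,\quad \nu(\Omega_r)=\tfrac13-\sum_{j\text{ even}}\mu_j,\quad \nu(\Omega_j)=\mu_j\ (j\ge 0),$$ and that $\tilde\Omega_j\subset\Omega_j$ are measurable with $\nu(\tilde\Omega_j)=\theta\mu_j$. Let $v_0:\Omega\to\mathbb R$ be measurable with $v_0=-1,0,1$ on $\Omega_l,\Omega_m,\Omega_r$ respectively, and, for every $j\ge0$, $v_0=(-1)^j\alpha_j$ on $\Omega_j\setminus\tilde\Omega_j$ and $\alpha_j\le(-1)^jv_0\le\alpha_{j-2}$ on $\tilde\Omega_j$. Let $u$ be the solution of (1) with $u(x,0)=v_0(x)-\int_\Omega v_0\,d\nu$ for all $x\in\Omega$. Assume that $$\alpha_j\le\mu_j\left(\frac{\alpha_{j-1}}2\right)^{1/\mu_j}\qquad\text{for all } j\ge1.$$ Then: (i) All points of $\Omega_m$ have a common phase transition time $\tau_m$,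 and for each $j\ge0$ all points of $\Omega_j\setminus\tilde\Omega_j$ have a common phase transition time $\tau_j$. These satisfy $\tau_m=+\infty$ and, for all $j\ge0$, $\tau_j<\tau_{j+1}$, $\tau_j<\infty$ and $$e^{\tau_j}\le\left(\frac{\alpha_j}2\right)^{-1/\mu_{j+1}}.$$ (ii) If moreover, for all sufficiently large $j$, $$\alpha_j\le\frac1{24}\left(\frac{\alpha_{j-1}}2\right)^{1/\mu_j}e^{-2\kappa_j},\qquad\text{where}\quad \kappa_j=\frac3{\mu_{j+1}}\log\left(\frac{18}{\mu_{j+1}}\right),$$ then for every $1\le p<\infty$, $u(\cdot,t)$ does not converge in $L^p(\Omega,\nu)$ as $t\to\infty$. -/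

import Mathlib

open MeasureTheory Filter Topology Set

namespace NonlocalODE

noncomputable section

/-- `u` is a global (forward in time) solution of
`∂ₜ u(x,t) = -f(u(x,t)) + ∫ f(u(y,t)) dν(y)`, `x ∈ X`, `t ≥ 0`,
with values in the bounded measurable functions on `X`.  The equation holds at every point `x`
(one-sided derivative at `t = 0`), and `u` is bounded on `X × [0,T]` for each `T`.  Only the values
of `u` at times `t ≥ 0` matter. -/
structure IsSolution {X : Type*} [MeasurableSpace X] (ν : Measure X) (f : ℝ → ℝ)
    (u : X → ℝ → ℝ) : Prop where
  measurable : ∀ t : ℝ, 0 ≤ t → Measurable fun x => u x t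
  locally_bounded : ∀ T : ℝ, ∃ C : ℝ, ∀ t ∈ Icc 0 T, ∀ x, |u x t| ≤ C
  equation : ∀ x, ∀ t : ℝ, 0 ≤ t →
    HasDerivWithinAt (u x) (-f (u x t) + ∫ y, f (u y t) ∂ν) (Ici 0) t

/-- The cubic nonlinearity `f(u) = u³ - u`. -/
def cubicForce (z : ℝ) : ℝ := z ^ 3 - z

/-- The left phase interval `[-2/√3, -1/√3]`. -/
def leftPhase : Set ℝ := Icc (-(2 / √3)) (-(1 / √3))

/-- The middle phase interval `(-1/√3, 1/√3)`. -/
def middlePhase : Set ℝ := Ioo (-(1 / √3)) (1 / √3)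

/-- The right phase interval `[1/√3, 2/√3]`. -/
def rightPhase : Set ℝ := Icc (1 / √3) (2 / √3)

/-- `τ ∈ (0,∞]` is the phase transition time of the trajectory `w : t ↦ w(t)`, `t ≥ 0`:
`w` is in the middle phase for `0 ≤ t < τ` and in the left or right phase for `t ≥ τ`.
There is at most one such `τ`, since the middle phase is disjoint from the other two. -/
def IsTransitionTime (w : ℝ → ℝ) (τ : EReal) : Prop :=
  0 < τ ∧ ∀ t : ℝ, 0 ≤ t →
    ((t : EReal) < τ → w t ∈ middlePhase) ∧
    (τ ≤ (t : EReal) → w t ∈ leftPhase ∪ rightPhase)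

/-- The masses `μ_j = μ₀ η^j`. -/
def mass (μ₀ η : ℝ) (j : ℕ) : ℝ := μ₀ * η ^ j

/-- The sequence `j ↦ α_{j-2}` for `j = 0, 1, 2, …`, with the convention `α_{-2} = α_{-1} = 1`. -/
def shiftTwo (α : ℕ → ℝ) : ℕ → ℝ
  | 0 => 1
  | 1 => 1
  | j + 2 => α j

/-- The constants `κ_j = (3 / μ_{j+1}) log (18 / μ_{j+1})`. -/
def kappa (μ₀ η : ℝ) (j : ℕ) : ℝ := 3 / mass μ₀ η (j + 1) * Real.log (18 / mass μ₀ η (j + 1))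

/-- The function `v₀` is structured as follows: the probability space is partitioned into measurable
pieces `L`, `M`, `R` and `P 0, P 1, P 2, …`, with transition zones `Z j ⊆ P j`, where
`ν(P j) = μ_j = μ₀ η^j`, `ν(Z j) = θ μ_j`, `ν(L) = 1/3 - ∑_{j odd} μ_j`, `ν(M) = 1/3` and
`ν(R) = 1/3 - ∑_{j even} μ_j`; the function `v₀` is measurable, it equals `-1, 0, 1` on `L, M, R`
respectively, it equals `(-1)^j α_j` on `P j \ Z j`, and
`α_j ≤ (-1)^j v₀ ≤ α_{j-2}` on `Z j` (with `α_{-2} = α_{-1} = 1`). -/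
structure IsPiecewiseData {X : Type*} [MeasurableSpace X] (ν : Measure X) (μ₀ η θ : ℝ)
    (α : ℕ → ℝ) (L M R : Set X) (P Z : ℕ → Set X) (v₀ : X → ℝ) : Prop where
  measurableSet_L : MeasurableSet L
  measurableSet_M : MeasurableSet M
  measurableSet_R : MeasurableSet R
  measurableSet_P : ∀ j, MeasurableSet (P j)
  measurableSet_Z : ∀ j, MeasurableSet (Z j)
  disjoint_LM : Disjoint L M
  disjoint_LR : Disjoint L R
  disjoint_MR : Disjoint M R
  disjoint_LP : ∀ j, Disjoint L (P j)
  disjoint_MP : ∀ j, Disjoint M (P j)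
  disjoint_RP : ∀ j, Disjoint R (P j)
  disjoint_PP : Pairwise fun i j => Disjoint (P i) (P j)
  cover : L ∪ M ∪ R ∪ (⋃ j, P j) = univ
  subset_P : ∀ j, Z j ⊆ P j
  mass_L : ν.real L = 1 / 3 - ∑' k : ℕ, mass μ₀ η (2 * k + 1)
  mass_M : ν.real M = 1 / 3
  mass_R : ν.real R = 1 / 3 - ∑' k : ℕ, mass μ₀ η (2 * k)
  mass_P : ∀ j, ν.real (P j) = mass μ₀ η j
  mass_Z : ∀ j, ν.real (Z j) = θ * mass μ₀ η j
  measurable_v : Measurable v₀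
  value_L : ∀ x ∈ L, v₀ x = -1
  value_M : ∀ x ∈ M, v₀ x = 0
  value_R : ∀ x ∈ R, v₀ x = 1
  value_P : ∀ j, ∀ x ∈ P j \ Z j, v₀ x = (-1) ^ j * α j
  value_Z : ∀ j, ∀ x ∈ Z j, α j ≤ (-1) ^ j * v₀ x ∧ (-1) ^ j * v₀ x ≤ shiftTwo α j

end

end NonlocalODE

open NonlocalODE

namespace NonlocalODE

/-! All points solve one scalar equation `w' = w - w³ + l(t)` with a common forcing, so the
difference of two trajectories obeys a linear equation (`hasDeriv_sub`): order is preserved and gaps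
grow at rate at most 1. Let a < b < c be the trajectories on L, M, R. The logarithm of the gap ratio
(c-b)/(b-a) has derivative -(c-a)(a+b+c) (`hasDeriv_ratio`), and conservation of the mean gives
a+b+c = 3(∫_E (c-u) - ∫_O (u-a)), where E and O are the unions of the small pieces to the right and
left of M (`sum_eq`). Thus the small pieces steer the middle trajectory.

For (i), reflect so that P k lies on the right. While P k is unsettled and P (k+1) clings to M,
neither gap can become too small compared with the other: P (k+1) resists in one direction, P k in
the other (`gap_ratio`). So b keeps away from the critical points, P k leaves M at rate at least
μ_{k+1} and settles by time log(2/α_k)/μ_{k+1} (`exists_settling_time`). The decay condition keeps P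
(k+1) within μ_{k+1} of M until then, so settling times increase. As the pieces have small mass, M
never leaves the middle phase (`neg_crit_lt_b`, `b_lt_crit`).

For (ii), once P k has settled, the settled pieces on its side collapse onto the outer trajectory
and lose their influence (`settled_decay`). The stronger decay keeps P (k+1) near M for a further
time 2κ, or until it settles. In the first case P (k+1) outweighs the remaining opposite pieces and
draws b to its own side; in either case b reaches distance 1/20 from the origin there
(`exists_le_b`). The side alternates with k and these times tend to infinity, so u oscillates on M,
a set of mass 1/3. -/

set_option linter.unusedSectionVars false

/-! ### Barriers and linear growth on the half-line -/

/-- A function on `[0,∞)` that starts above the level `ρ` and does not decrease while it is below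
`ρ` stays above `ρ`. -/
theorem le_of_deriv_nonneg_below {φ φ' : ℝ → ℝ} {t₀ T ρ : ℝ} (ht₀ : 0 ≤ t₀)
    (hφ : ∀ t, 0 ≤ t → HasDerivWithinAt φ (φ' t) (Ici 0) t) (h0 : ρ ≤ φ t₀)
    (hpos : ∀ t ∈ Icc t₀ T, φ t < ρ → 0 ≤ φ' t) : ∀ t ∈ Icc t₀ T, ρ ≤ φ t := by
  intro t ht
  by_contra! hlt
  have hcont : ContinuousOn φ (Icc t₀ t) := fun x hx =>
    ((hφ x (ht₀.trans hx.1)).continuousWithinAt).mono fun z hz => ht₀.trans hz.1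
  -- The supremum of `S` is the last time at or above the level; from there to `t` the function is
  -- below `ρ`, hence nondecreasing, a contradiction.
  set S : Set ℝ := Icc t₀ t ∩ φ ⁻¹' (Ici ρ)
  have hSc : IsClosed S := hcont.preimage_isClosed_of_isClosed isClosed_Icc isClosed_Ici
  have hSne : S.Nonempty := ⟨t₀, ⟨le_rfl, ht.1⟩, h0⟩
  have hSb : BddAbove S := ⟨t, fun x hx => hx.1.2⟩
  have hmem := hSc.csSup_mem hSne hSb
  set r := sSup S
  have hrt : r ≤ t := hmem.1.2
  have hr0 : t₀ ≤ r := hmem.1.1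
  have hbelow : ∀ x ∈ Ioc r t, φ x < ρ := by
    intro x hx
    by_contra! h
    exact absurd (le_csSup hSb (show x ∈ S from ⟨⟨hr0.trans hx.1.le, hx.2⟩, h⟩)) (not_le.2 hx.1)
  have hmono : MonotoneOn φ (Icc r t) := by
    refine monotoneOn_of_hasDerivWithinAt_nonneg (convex_Icc r t)
      (hcont.mono (Icc_subset_Icc_left hr0)) (f' := φ') ?_ ?_
    · intro x hx
      rw [interior_Icc] at hx ⊢
      exact (hφ x (ht₀.trans (hr0.trans hx.1.le))).mono
        fun z hz => ht₀.trans (hr0.trans hz.1.le)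
    · intro x hx
      rw [interior_Icc] at hx
      exact hpos x ⟨hr0.trans hx.1.le, hx.2.le.trans ht.2⟩ (hbelow x ⟨hx.1, hx.2.le⟩)
  have := hmono (left_mem_Icc.2 hrt) (right_mem_Icc.2 hrt) hrt
  exact absurd (hmem.2.trans this) (not_le.2 hlt)

theorem sub_ge_mul_of_deriv_ge {φ φ' : ℝ → ℝ} {s t K : ℝ} (hs : 0 ≤ s) (hst : s ≤ t)
    (hφ : ∀ r, 0 ≤ r → HasDerivWithinAt φ (φ' r) (Ici 0) r)
    (hK : ∀ r ∈ Icc s t, K ≤ φ' r) : K * (t - s) ≤ φ t - φ s := by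
  have hψ : ∀ r, 0 ≤ r → HasDerivWithinAt (fun r => φ r - K * r) (φ' r - K) (Ici 0) r := by
    intro r hr
    exact ((hφ r hr).sub ((hasDerivWithinAt_id r (Ici 0)).const_mul K)).congr_deriv (by simp)
  have := le_of_deriv_nonneg_below (T := t) hs hψ le_rfl
    (fun r hr _ => sub_nonneg.2 (hK r hr)) t ⟨hst, le_rfl⟩
  linarith

/-- `D' ≥ -K D` on `[0,T)` implies `D T ≥ D 0 * exp (-K T)`. -/
theorem mul_exp_le_of_deriv_ge {D D' : ℝ → ℝ} {T K : ℝ} (hT : 0 ≤ T)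
    (hD : ∀ t, 0 ≤ t → HasDerivWithinAt D (D' t) (Ici 0) t)
    (hK : ∀ t ∈ Ico 0 T, -K * D t ≤ D' t) : D 0 * Real.exp (-K * T) ≤ D T := by
  have hmono : MonotoneOn (fun t => D t * Real.exp (K * t)) (Icc 0 T) := by
    have hder : ∀ t, 0 ≤ t → HasDerivWithinAt (fun t => D t * Real.exp (K * t))
        (D' t * Real.exp (K * t) + D t * (Real.exp (K * t) * K)) (Ici 0) t := by
      intro t ht
      refine (hD t ht).mul (HasDerivAt.hasDerivWithinAt ?_)
      simpa using ((hasDerivAt_id t).const_mul K).exp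
    refine monotoneOn_of_hasDerivWithinAt_nonneg (convex_Icc 0 T)
      (f' := fun t => D' t * Real.exp (K * t) + D t * (Real.exp (K * t) * K))
      (fun x hx => ((hder x hx.1).continuousWithinAt).mono fun z hz => hz.1) (fun x hx => ?_)
      (fun x hx => ?_)
    · rw [interior_Icc] at hx ⊢
      exact (hder x hx.1.le).mono fun z hz => hz.1.le
    · rw [interior_Icc] at hx
      have h1 := hK x ⟨hx.1.le, hx.2⟩
      have h2 : 0 ≤ (D' x + K * D x) * Real.exp (K * x) :=
        mul_nonneg (by linarith) (Real.exp_pos _).le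
      linarith
  have h := hmono (left_mem_Icc.2 hT) (right_mem_Icc.2 hT) hT
  simp only [mul_zero, Real.exp_zero, mul_one] at h
  calc D 0 * Real.exp (-K * T) ≤ D T * Real.exp (K * T) * Real.exp (-K * T) :=
        mul_le_mul_of_nonneg_right h (Real.exp_pos _).le
    _ = D T := by rw [mul_assoc, ← Real.exp_add]; simp

/-- Solutions of the linear equation `D' = q D`. -/
theorem exists_eq_mul_exp {D q : ℝ → ℝ}
    (hD : ∀ t, 0 ≤ t → HasDerivWithinAt D (D t * q t) (Ici 0) t) (hq : ContinuousOn q (Ici 0)) :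
    ∃ Q : ℝ → ℝ, (∀ t, 0 ≤ t → HasDerivWithinAt Q (q t) (Ici 0) t) ∧
      ∀ s t, 0 ≤ s → s ≤ t → D t = D s * Real.exp (Q t - Q s) := by
  -- Freezing `q` at its value at 0 for negative times makes it continuous on the whole line, so a
  -- primitive exists.
  have hc : Continuous fun t : ℝ => q (max t 0) :=
    hq.comp_continuous (by fun_prop) fun t => le_max_right t 0
  set Q : ℝ → ℝ := fun t => ∫ r in (0:ℝ)..t, q (max r 0)
  have hQ : ∀ t, 0 ≤ t → HasDerivWithinAt Q (q t) (Ici 0) t := by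
    intro t ht
    have := (hc.integral_hasStrictDerivAt 0 t).hasDerivAt.hasDerivWithinAt (s := Ici 0)
    simpa [max_eq_left ht] using this
  refine ⟨Q, hQ, ?_⟩
  have key : ∀ t, 0 ≤ t → HasDerivWithinAt (fun t => D t * Real.exp (-Q t)) 0 (Ici 0) t := by
    intro t ht
    refine ((hD t ht).mul (hQ t ht).neg.exp).congr_deriv ?_
    simp only [Pi.neg_apply]
    ring
  intro s t hs hst
  have h1 := sub_ge_mul_of_deriv_ge hs hst key (K := 0) (fun _ _ => le_rfl)
  have h2 := sub_ge_mul_of_deriv_ge hs hst (fun r hr => (key r hr).neg) (K := 0)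
    (fun _ _ => by simp)
  have h3 : D t * Real.exp (-Q t) = D s * Real.exp (-Q s) := by
    simp only [Pi.neg_apply] at h2
    linarith
  calc D t = D t * Real.exp (-Q t) * Real.exp (Q t) := by
        rw [mul_assoc, ← Real.exp_add]; simp
    _ = D s * Real.exp (Q t - Q s) := by
        rw [h3, mul_assoc, ← Real.exp_add]; congr 2; ring

theorem growth_ge {D q : ℝ → ℝ} {s t K : ℝ}
    (hD : ∀ t, 0 ≤ t → HasDerivWithinAt D (D t * q t) (Ici 0) t) (hq : ContinuousOn q (Ici 0))
    (hs : 0 ≤ s) (hst : s ≤ t) (h0 : 0 ≤ D s) (hK : ∀ r ∈ Icc s t, K ≤ q r) :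
    D s * Real.exp (K * (t - s)) ≤ D t := by
  obtain ⟨Q, hQ, h⟩ := exists_eq_mul_exp hD hq
  rw [h s t hs hst]
  exact mul_le_mul_of_nonneg_left (Real.exp_le_exp.2 (sub_ge_mul_of_deriv_ge hs hst hQ hK)) h0

theorem growth_le {D q : ℝ → ℝ} {s t K : ℝ}
    (hD : ∀ t, 0 ≤ t → HasDerivWithinAt D (D t * q t) (Ici 0) t) (hq : ContinuousOn q (Ici 0))
    (hs : 0 ≤ s) (hst : s ≤ t) (h0 : 0 ≤ D s) (hK : ∀ r ∈ Icc s t, q r ≤ K) :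
    D t ≤ D s * Real.exp (K * (t - s)) := by
  obtain ⟨Q, hQ, h⟩ := exists_eq_mul_exp hD hq
  rw [h s t hs hst]
  refine mul_le_mul_of_nonneg_left (Real.exp_le_exp.2 ?_) h0
  have := sub_ge_mul_of_deriv_ge hs hst (fun r hr => (hQ r hr).neg) (K := -K)
    (fun r hr => neg_le_neg (hK r hr))
  simp only [Pi.neg_apply] at this
  linarith

/-! ### Trajectories with a common forcing -/

/-- `w` solves `w' = w - w³ + l` on `[0,∞)`. -/
def IsTrajectory (l w : ℝ → ℝ) : Prop :=
  ∀ t, 0 ≤ t → HasDerivWithinAt w (w t - w t ^ 3 + l t) (Ici 0) t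

namespace IsTrajectory

variable {l w₁ w₂ w₃ : ℝ → ℝ}

theorem continuousOn (h : IsTrajectory l w₁) : ContinuousOn w₁ (Ici 0) :=
  fun t ht => (h t ht).continuousWithinAt

theorem neg (h : IsTrajectory l w₁) : IsTrajectory (fun t => -l t) (fun t => -w₁ t) := by
  intro t ht
  refine ((h t ht).neg).congr_deriv ?_
  ring

theorem continuousOn_quad (h₁ : IsTrajectory l w₁) (h₂ : IsTrajectory l w₂) :
    ContinuousOn (fun t => 1 - (w₁ t ^ 2 + w₁ t * w₂ t + w₂ t ^ 2)) (Ici 0) := by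
  have := h₁.continuousOn
  have := h₂.continuousOn
  fun_prop

/-- The forcing cancels, and the cube difference factors out `w₂ - w₁`. Ordering, uniqueness and all
growth estimates follow from this linear equation. -/
theorem hasDeriv_sub (h₁ : IsTrajectory l w₁) (h₂ : IsTrajectory l w₂) (t : ℝ) (ht : 0 ≤ t) :
    HasDerivWithinAt (fun t => w₂ t - w₁ t)
      ((w₂ t - w₁ t) * (1 - (w₁ t ^ 2 + w₁ t * w₂ t + w₂ t ^ 2))) (Ici 0) t := by
  refine ((h₂ t ht).sub (h₁ t ht)).congr_deriv ?_
  ring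

theorem lt_of_lt (h₁ : IsTrajectory l w₁) (h₂ : IsTrajectory l w₂) {s t : ℝ} (hs : 0 ≤ s)
    (hst : s ≤ t) (h : w₁ s < w₂ s) : w₁ t < w₂ t := by
  obtain ⟨Q, -, hQ⟩ := exists_eq_mul_exp (h₁.hasDeriv_sub h₂) (h₁.continuousOn_quad h₂)
  have h1 : w₂ t - w₁ t = _ := hQ s t hs hst
  have h2 : 0 < (w₂ s - w₁ s) * Real.exp (Q t - Q s) :=
    mul_pos (sub_pos.2 h) (Real.exp_pos _)
  linarith

theorem eq_of_eq (h₁ : IsTrajectory l w₁) (h₂ : IsTrajectory l w₂) (h : w₁ 0 = w₂ 0) {t : ℝ}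
    (ht : 0 ≤ t) : w₁ t = w₂ t := by
  obtain ⟨Q, -, hQ⟩ := exists_eq_mul_exp (h₁.hasDeriv_sub h₂) (h₁.continuousOn_quad h₂)
  have h1 : w₂ t - w₁ t = (w₂ 0 - w₁ 0) * _ := hQ 0 t le_rfl ht
  rw [h, sub_self, zero_mul] at h1
  linarith

theorem le_of_le (h₁ : IsTrajectory l w₁) (h₂ : IsTrajectory l w₂) (h : w₁ 0 ≤ w₂ 0) {t : ℝ}
    (ht : 0 ≤ t) : w₁ t ≤ w₂ t := by
  rcases h.lt_or_eq with h | h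
  · exact (h₁.lt_of_lt h₂ le_rfl ht h).le
  · exact (h₁.eq_of_eq h₂ h ht).le

/-- The quadratic form in the rate is nonnegative, so the rate is at most 1. This is what keeps a
piece of tiny height close to M for a long time. -/
theorem sub_le_mul_exp (h₁ : IsTrajectory l w₁) (h₂ : IsTrajectory l w₂) (h : w₁ 0 ≤ w₂ 0) {t : ℝ}
    (ht : 0 ≤ t) : w₂ t - w₁ t ≤ (w₂ 0 - w₁ 0) * Real.exp t := by
  have hq : ∀ r ∈ Icc 0 t, 1 - (w₁ r ^ 2 + w₁ r * w₂ r + w₂ r ^ 2) ≤ 1 := fun r _ => by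
    nlinarith [sq_nonneg (w₁ r + w₂ r), sq_nonneg (w₁ r), sq_nonneg (w₂ r)]
  simpa using growth_le (h₁.hasDeriv_sub h₂) (h₁.continuousOn_quad h₂) le_rfl ht
    (sub_nonneg.2 h) hq

/-- The ratio of two consecutive gaps of an ordered triple of trajectories. -/
theorem hasDeriv_ratio (h₁ : IsTrajectory l w₁) (h₂ : IsTrajectory l w₂) (h₃ : IsTrajectory l w₃)
    (t : ℝ) (ht : 0 ≤ t) (h : w₁ t ≠ w₂ t) :
    HasDerivWithinAt (fun t => (w₃ t - w₂ t) / (w₂ t - w₁ t))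
      ((w₃ t - w₂ t) / (w₂ t - w₁ t) * (-((w₃ t - w₁ t) * (w₁ t + w₂ t + w₃ t)))) (Ici 0) t := by
  -- The rates of the two gaps differ by `w₁² + w₁w₂ - w₂w₃ - w₃²`, which has the factor `w₃ - w₁`.
  -- The order of the three trajectories plays no role.
  have hne : w₂ t - w₁ t ≠ 0 := sub_ne_zero.2 h.symm
  refine ((h₂.hasDeriv_sub h₃ t ht).div (h₁.hasDeriv_sub h₂ t ht) hne).congr_deriv ?_
  field_simp
  ring

theorem continuousOn_rate (h₁ : IsTrajectory l w₁) (h₂ : IsTrajectory l w₂)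
    (h₃ : IsTrajectory l w₃) :
    ContinuousOn (fun t => -((w₃ t - w₁ t) * (w₁ t + w₂ t + w₃ t))) (Ici 0) := by
  have := h₁.continuousOn
  have := h₂.continuousOn
  have := h₃.continuousOn
  fun_prop

end IsTrajectory

/-! ### The critical point of the cubic -/

/-- The critical point `1/√3` of the nonlinearity. -/
noncomputable def crit : ℝ := 1 / √3

theorem crit_pos : 0 < crit := by unfold crit; positivity

theorem crit_sq : crit ^ 2 = 1 / 3 := by
  unfold crit
  rw [div_pow, Real.sq_sqrt (by norm_num)]
  norm_num

theorem lt_crit : 0.577 < crit := by nlinarith [crit_sq, crit_pos]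

theorem crit_lt : crit < 0.578 := by nlinarith [crit_sq, crit_pos]

theorem crit_cube : crit ^ 3 = crit / 3 := by
  rw [pow_succ, crit_sq]; ring

/-- The local extreme value at `crit` is taken again at `-2 crit`: `z³ - z + 2/3 crit = (z -
crit)²(z + 2 crit)`, and symmetrically at the other end. -/
theorem abs_cubicForce_le {z : ℝ} (h₁ : -(2 * crit) ≤ z) (h₂ : z ≤ 2 * crit) :
    |cubicForce z| ≤ 2 / 3 * crit := by
  have e := crit_sq
  have e' := crit_cube
  unfold cubicForce
  rw [abs_le]
  constructor
  · nlinarith [mul_nonneg (sq_nonneg (z - crit)) (show 0 ≤ z + 2 * crit by linarith)]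
  · nlinarith [mul_nonneg (sq_nonneg (z + crit)) (show 0 ≤ 2 * crit - z by linarith)]

/-! ### The nonlocal term and conservation of the mean -/

section Solution

variable {X : Type*} [MeasurableSpace X] {ν : Measure X} [IsProbabilityMeasure ν]
  {u : X → ℝ → ℝ}

/-- The nonlocal term of the equation. -/
noncomputable def force (ν : Measure X) (u : X → ℝ → ℝ) (t : ℝ) : ℝ :=
  ∫ y, cubicForce (u y t) ∂ν

theorem measurable_cubicForce : Measurable cubicForce := by
  unfold cubicForce; fun_prop

theorem cubicForce_neg (z : ℝ) : cubicForce (-z) = -cubicForce z := by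
  unfold cubicForce; ring

theorem abs_force_le {t K : ℝ} (hK : ∀ x, |cubicForce (u x t)| ≤ K) : |force ν u t| ≤ K := by
  have := norm_integral_le_of_norm_le_const (μ := ν) (f := fun x => cubicForce (u x t))
    (Eventually.of_forall hK)
  simpa [force] using this

namespace IsSolution

theorem isTrajectory (h : IsSolution ν cubicForce u) (x : X) :
    IsTrajectory (force ν u) (u x) := by
  intro t ht
  refine (h.equation x t ht).congr_deriv ?_
  simp only [force, cubicForce]
  ring

theorem integrable (h : IsSolution ν cubicForce u) {t : ℝ} (ht : 0 ≤ t) :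
    Integrable (fun x => u x t) ν := by
  obtain ⟨C, hC⟩ := h.locally_bounded t
  exact Integrable.of_bound (h.measurable t ht).aestronglyMeasurable C
    (Eventually.of_forall fun x => hC t ⟨ht, le_rfl⟩ x)

theorem exists_force_bound (h : IsSolution ν cubicForce u) (T : ℝ) :
    ∃ K : ℝ, ∀ t ∈ Icc 0 T, ∀ x, |cubicForce (u x t)| ≤ K := by
  obtain ⟨C, hC⟩ := h.locally_bounded T
  refine ⟨C ^ 3 + C, fun t ht x => ?_⟩
  have h1 := hC t ht x
  calc |cubicForce (u x t)| ≤ |u x t ^ 3| + |u x t| := abs_sub _ _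
    _ ≤ C ^ 3 + C := by
      rw [abs_pow]
      exact add_le_add (pow_le_pow_left₀ (abs_nonneg _) h1 3) h1

theorem integrable_force (h : IsSolution ν cubicForce u) {t : ℝ} (ht : 0 ≤ t) :
    Integrable (fun x => cubicForce (u x t)) ν := by
  obtain ⟨K, hK⟩ := h.exists_force_bound t
  exact Integrable.of_bound
    (measurable_cubicForce.comp (h.measurable t ht)).aestronglyMeasurable K
    (Eventually.of_forall fun x => hK t ⟨ht, le_rfl⟩ x)

/-- The mean value of a solution is conserved. -/
theorem integral_eq (h : IsSolution ν cubicForce u) {T : ℝ} (hT : 0 ≤ T) :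
    ∫ x, u x T ∂ν = ∫ x, u x 0 ∂ν := by
  set F : ℝ → ℝ := fun t => ∫ x, u x t ∂ν
  have hcont : ContinuousOn F (Icc 0 T) := by
    intro t ht
    obtain ⟨C, hC⟩ := h.locally_bounded T
    refine continuousWithinAt_of_dominated (bound := fun _ => C) ?_ ?_ (integrable_const C) ?_
    · filter_upwards [self_mem_nhdsWithin] with r hr
      exact (h.measurable r hr.1).aestronglyMeasurable
    · filter_upwards [self_mem_nhdsWithin] with r hr
      exact Eventually.of_forall fun x => hC r hr x
    · exact Eventually.of_forall fun x =>
        ((h.isTrajectory x).continuousOn t ht.1).mono fun r hr => hr.1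
  have hder : ∀ t ∈ Ioo 0 T, HasDerivAt F 0 t := by
    intro t ht
    obtain ⟨K, hK⟩ := h.exists_force_bound T
    have hmeas := (measurable_cubicForce.comp (h.measurable t ht.1.le))
    have key := hasDerivAt_integral_of_dominated_loc_of_deriv_le (μ := ν) (x₀ := t)
      (s := Ioo 0 T) (F := fun t x => u x t) (bound := fun _ => K + K)
      (F' := fun t x => -cubicForce (u x t) + ∫ y, cubicForce (u y t) ∂ν)
      (Ioo_mem_nhds ht.1 ht.2) ?_ (h.integrable ht.1.le) ?_ ?_ (integrable_const _) ?_
    · have h0 : ∫ x, (-cubicForce (u x t) + ∫ y, cubicForce (u y t) ∂ν) ∂ν = 0 := by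
        have h1 : Integrable (fun x => -cubicForce (u x t)) ν :=
          (h.integrable_force ht.1.le).neg
        rw [integral_add h1 (integrable_const _), integral_neg]
        simp
      rw [h0] at key
      exact key.2
    · filter_upwards [Ioo_mem_nhds ht.1 ht.2] with r hr
      exact (h.measurable r hr.1.le).aestronglyMeasurable
    · exact (hmeas.neg.add measurable_const).aestronglyMeasurable
    · refine Eventually.of_forall fun x r hr => ?_
      have hr' : r ∈ Icc 0 T := Ioo_subset_Icc_self hr
      refine (norm_add_le _ _).trans (add_le_add ?_ ?_)
      · simpa using hK r hr' x
      · exact abs_force_le (hK r hr')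
    · refine Eventually.of_forall fun x r hr => ?_
      exact (h.equation x r hr.1.le).hasDerivAt (Ici_mem_nhds hr.1)
  have h1 : MonotoneOn F (Icc 0 T) :=
    monotoneOn_of_hasDerivWithinAt_nonneg (convex_Icc 0 T) hcont (f' := fun _ => 0)
      (fun x hx => by rw [interior_Icc] at hx; exact (hder x hx).hasDerivWithinAt)
      (fun _ _ => le_rfl)
  have h2 : AntitoneOn F (Icc 0 T) :=
    antitoneOn_of_hasDerivWithinAt_nonpos (convex_Icc 0 T) hcont (f' := fun _ => 0)
      (fun x hx => by rw [interior_Icc] at hx; exact (hder x hx).hasDerivWithinAt)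
      (fun _ _ => le_rfl)
  exact le_antisymm (h2 (left_mem_Icc.2 hT) (right_mem_Icc.2 hT) hT)
    (h1 (left_mem_Icc.2 hT) (right_mem_Icc.2 hT) hT)

theorem force_neg : force ν (fun x t => -u x t) = fun t => -force ν u t := by
  funext t
  simp only [force, cubicForce_neg, integral_neg]

theorem neg (h : IsSolution ν cubicForce u) : IsSolution ν cubicForce fun x t => -u x t where
  measurable t ht := (h.measurable t ht).neg
  locally_bounded T := by
    obtain ⟨C, hC⟩ := h.locally_bounded T
    exact ⟨C, fun t ht x => by simpa using hC t ht x⟩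
  equation x t ht := by
    refine ((h.equation x t ht).neg).congr_deriv ?_
    simp only [cubicForce_neg, integral_neg]
    ring

end IsSolution

/-! ### Frames: balance of the phases and a priori bounds -/

/-- A solution together with its trajectories `a`, `b`, `c` on the three phases `L`, `M`, `R`, and
with small sets `O` and `E` of points which start between `L` and `M` and between `M` and `R`
and whose masses complement those of `L` and `R` to `1/3`. -/
structure IsFrame (ν : Measure X) (u : X → ℝ → ℝ) (a b c : ℝ → ℝ) (L M R E O : Set X) :
    Prop where
  sol : IsSolution ν cubicForce u
  mean : ∫ x, u x 0 ∂ν = 0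
  split : ∀ h : X → ℝ, Integrable h ν → ∫ x, h x ∂ν =
    ∫ x in L, h x ∂ν + ∫ x in M, h x ∂ν + ∫ x in R, h x ∂ν + ∫ x in E, h x ∂ν + ∫ x in O, h x ∂ν
  measurable_L : MeasurableSet L
  measurable_M : MeasurableSet M
  measurable_R : MeasurableSet R
  measurable_E : MeasurableSet E
  measurable_O : MeasurableSet O
  traj_a : IsTrajectory (force ν u) a
  traj_b : IsTrajectory (force ν u) b
  traj_c : IsTrajectory (force ν u) c
  on_L : ∀ x ∈ L, u x 0 = a 0
  on_M : ∀ x ∈ M, u x 0 = b 0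
  on_R : ∀ x ∈ R, u x 0 = c 0
  on_E : ∀ x ∈ E, b 0 < u x 0
  on_O : ∀ x ∈ O, u x 0 < b 0
  range : ∀ x, a 0 ≤ u x 0 ∧ u x 0 ≤ c 0
  gap_left : b 0 - a 0 = 1
  gap_right : c 0 - b 0 = 1
  mass_M : ν.real M = 1 / 3
  mass_LO : ν.real L + ν.real O = 1 / 3
  mass_RE : ν.real R + ν.real E = 1 / 3
  mass_E : ν.real E ≤ 0.102
  mass_O : ν.real O ≤ 0.102

namespace IsFrame

variable {a b c : ℝ → ℝ} {L M R E O : Set X}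

/-- The cubic is odd, so reflection exchanges left and right; every one-sided estimate then yields
its mirror image. -/
theorem neg (h : IsFrame ν u a b c L M R E O) :
    IsFrame ν (fun x t => -u x t) (fun t => -c t) (fun t => -b t) (fun t => -a t) R M L O E where
  sol := h.sol.neg
  mean := by rw [integral_neg, h.mean, neg_zero]
  split k hk := by rw [h.split k hk]; ring
  measurable_L := h.measurable_R
  measurable_M := h.measurable_M
  measurable_R := h.measurable_L
  measurable_E := h.measurable_O
  measurable_O := h.measurable_E
  traj_a := by rw [IsSolution.force_neg]; exact h.traj_c.neg
  traj_b := by rw [IsSolution.force_neg]; exact h.traj_b.neg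
  traj_c := by rw [IsSolution.force_neg]; exact h.traj_a.neg
  on_L x hx := by rw [h.on_R x hx]
  on_M x hx := by rw [h.on_M x hx]
  on_R x hx := by rw [h.on_L x hx]
  on_E x hx := neg_lt_neg (h.on_O x hx)
  on_O x hx := neg_lt_neg (h.on_E x hx)
  range x := ⟨neg_le_neg (h.range x).2, neg_le_neg (h.range x).1⟩
  gap_left := by linarith [h.gap_right]
  gap_right := by linarith [h.gap_left]
  mass_M := h.mass_M
  mass_LO := h.mass_RE
  mass_RE := h.mass_LO
  mass_E := h.mass_O
  mass_O := h.mass_E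

theorem a_le (h : IsFrame ν u a b c L M R E O) (x : X) {t : ℝ} (ht : 0 ≤ t) : a t ≤ u x t :=
  h.traj_a.le_of_le (h.sol.isTrajectory x) (h.range x).1 ht

theorem le_c (h : IsFrame ν u a b c L M R E O) (x : X) {t : ℝ} (ht : 0 ≤ t) : u x t ≤ c t :=
  (h.sol.isTrajectory x).le_of_le h.traj_c (h.range x).2 ht

theorem a_lt_b (h : IsFrame ν u a b c L M R E O) {t : ℝ} (ht : 0 ≤ t) : a t < b t :=
  h.traj_a.lt_of_lt h.traj_b le_rfl ht (by linarith [h.gap_left])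

theorem b_lt_c (h : IsFrame ν u a b c L M R E O) {t : ℝ} (ht : 0 ≤ t) : b t < c t :=
  h.traj_b.lt_of_lt h.traj_c le_rfl ht (by linarith [h.gap_right])

theorem b_lt (h : IsFrame ν u a b c L M R E O) {x : X} (hx : x ∈ E) {t : ℝ} (ht : 0 ≤ t) :
    b t < u x t :=
  h.traj_b.lt_of_lt (h.sol.isTrajectory x) le_rfl ht (h.on_E x hx)

theorem lt_b (h : IsFrame ν u a b c L M R E O) {x : X} (hx : x ∈ O) {t : ℝ} (ht : 0 ≤ t) :
    u x t < b t :=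
  (h.sol.isTrajectory x).lt_of_lt h.traj_b le_rfl ht (h.on_O x hx)

theorem integrable_c_sub (h : IsFrame ν u a b c L M R E O) {t : ℝ} (ht : 0 ≤ t) :
    Integrable (fun x => c t - u x t) ν :=
  (integrable_const _).sub (h.sol.integrable ht)

theorem integrable_sub_a (h : IsFrame ν u a b c L M R E O) {t : ℝ} (ht : 0 ≤ t) :
    Integrable (fun x => u x t - a t) ν :=
  (h.sol.integrable ht).sub (integrable_const _)

/-- The sum of the three trajectories measures the imbalance of the phases. -/
theorem sum_eq (h : IsFrame ν u a b c L M R E O) {t : ℝ} (ht : 0 ≤ t) :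
    a t + b t + c t = 3 * (∫ x in E, (c t - u x t) ∂ν - ∫ x in O, (u x t - a t) ∂ν) := by
  -- The zero mean persists. On L, M, R the solution is a, b, c, and the deficits of L and R from
  -- mass 1/3 are the masses of O and E.
  have h0 : ∫ x, u x t ∂ν = 0 := (h.sol.integral_eq ht).trans h.mean
  have hi := h.sol.integrable ht
  rw [h.split _ hi] at h0
  have hconst : ∀ (S : Set X) (w : ℝ → ℝ), MeasurableSet S → IsTrajectory (force ν u) w →
      (∀ x ∈ S, u x 0 = w 0) → ∫ x in S, u x t ∂ν = ν.real S * w t := by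
    intro S w hS hw hSw
    rw [setIntegral_congr_fun (g := fun _ => w t) hS
      (fun x hx => (h.sol.isTrajectory x).eq_of_eq hw (hSw x hx) ht), setIntegral_const,
      smul_eq_mul]
  rw [hconst L a h.measurable_L h.traj_a h.on_L, hconst M b h.measurable_M h.traj_b h.on_M,
    hconst R c h.measurable_R h.traj_c h.on_R, h.mass_M] at h0
  rw [integral_sub (integrable_const _) hi.integrableOn,
    integral_sub hi.integrableOn (integrable_const _), setIntegral_const, setIntegral_const,
    smul_eq_mul, smul_eq_mul]
  have h1 : ν.real L = 1 / 3 - ν.real O := by linarith [h.mass_LO]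
  have h2 : ν.real R = 1 / 3 - ν.real E := by linarith [h.mass_RE]
  rw [h1, h2] at h0
  linarith

theorem integral_E_le (h : IsFrame ν u a b c L M R E O) {t : ℝ} (ht : 0 ≤ t) :
    ∫ x in E, (c t - u x t) ∂ν ≤ ν.real E * (c t - b t) := by
  calc ∫ x in E, (c t - u x t) ∂ν ≤ ∫ _ in E, (c t - b t) ∂ν :=
        setIntegral_mono_on (h.integrable_c_sub ht).integrableOn (integrable_const _)
          h.measurable_E fun x hx => by linarith [h.b_lt hx ht]
    _ = _ := by rw [setIntegral_const, smul_eq_mul]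

/-- A subset of `E` on which `u ≤ w` bounds the integral of `c - u` from below. -/
theorem le_integral_E (h : IsFrame ν u a b c L M R E O) {t : ℝ} (ht : 0 ≤ t) {K : Set X} {w : ℝ}
    (hK : MeasurableSet K) (hKE : K ⊆ E) (hw : ∀ x ∈ K, u x t ≤ w) :
    ν.real K * (c t - w) ≤ ∫ x in E, (c t - u x t) ∂ν := by
  calc ν.real K * (c t - w) = ∫ _ in K, (c t - w) ∂ν := by rw [setIntegral_const, smul_eq_mul]
    _ ≤ ∫ x in K, (c t - u x t) ∂ν :=
        setIntegral_mono_on (integrable_const _) (h.integrable_c_sub ht).integrableOn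
          hK fun x hx => by linarith [hw x hx]
    _ ≤ ∫ x in E, (c t - u x t) ∂ν :=
        setIntegral_mono_set (h.integrable_c_sub ht).integrableOn
          (ae_restrict_of_forall_mem h.measurable_E fun x _ => sub_nonneg.2 (h.le_c x ht))
          (Eventually.of_forall hKE)

theorem integral_O_nonneg (h : IsFrame ν u a b c L M R E O) {t : ℝ} (ht : 0 ≤ t) :
    0 ≤ ∫ x in O, (u x t - a t) ∂ν :=
  setIntegral_nonneg h.measurable_O fun x _ => sub_nonneg.2 (h.a_le x ht)

theorem integral_O_le (h : IsFrame ν u a b c L M R E O) {t : ℝ} (ht : 0 ≤ t) :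
    ∫ x in O, (u x t - a t) ∂ν ≤ ν.real O * (b t - a t) := by
  have := h.neg.integral_E_le ht
  calc _ = ∫ x in O, (-a t - -u x t) ∂ν := by congr 1; ext x; ring
    _ ≤ _ := this
    _ = _ := by ring

theorem le_integral_O (h : IsFrame ν u a b c L M R E O) {t : ℝ} (ht : 0 ≤ t) {K : Set X} {w : ℝ}
    (hK : MeasurableSet K) (hKO : K ⊆ O) (hw : ∀ x ∈ K, w ≤ u x t) :
    ν.real K * (w - a t) ≤ ∫ x in O, (u x t - a t) ∂ν := by
  have := h.neg.le_integral_E ht hK hKO (w := -w) fun x hx => neg_le_neg (hw x hx)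
  calc _ = ν.real K * (-a t - -w) := by ring
    _ ≤ _ := this
    _ = _ := by congr 1; ext x; ring

/-- In `sum_eq` the set O only lowers the sum, and E contributes at most `3 · 0.102 · (c - b)`. -/
theorem sum_le (h : IsFrame ν u a b c L M R E O) {t : ℝ} (ht : 0 ≤ t) :
    a t + b t + c t ≤ 0.306 * (c t - b t) := by
  have h1 := mul_le_mul_of_nonneg_right h.mass_E (sub_pos.2 (h.b_lt_c ht)).le
  linarith [h.sum_eq ht, h.integral_E_le ht, h.integral_O_nonneg ht]

theorem le_sum (h : IsFrame ν u a b c L M R E O) {t : ℝ} (ht : 0 ≤ t) :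
    -(0.306 * (b t - a t)) ≤ a t + b t + c t := by
  have := h.neg.sum_le ht
  linarith

/-- As long as all values lie in `[-2 crit, 2 crit]`, the forcing is at most `2/3 crit` in modulus,
for which the endpoints are at worst equilibria. The distances to them then decay at most
exponentially, so they are still positive at a putative first exit time. -/
theorem bounds (h : IsFrame ν u a b c L M R E O) :
    ∀ t, 0 ≤ t → -(2 * crit) < a t ∧ c t < 2 * crit := by
  by_contra! hcon
  obtain ⟨t₁, ht₁, hbad⟩ := hcon
  set m : ℝ → ℝ := fun t => min (2 * crit - c t) (a t + 2 * crit) with hm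
  have hmc : ContinuousOn m (Icc 0 t₁) := by
    have := h.traj_a.continuousOn.mono (Icc_subset_Ici_self : Icc 0 t₁ ⊆ Ici 0)
    have := h.traj_c.continuousOn.mono (Icc_subset_Ici_self : Icc 0 t₁ ⊆ Ici 0)
    fun_prop
  set S := Icc 0 t₁ ∩ m ⁻¹' Iic 0
  have hSc : IsClosed S := hmc.preimage_isClosed_of_isClosed isClosed_Icc isClosed_Iic
  have hSne : S.Nonempty := by
    refine ⟨t₁, ⟨ht₁, le_rfl⟩, ?_⟩
    simp only [hm, mem_preimage, mem_Iic, min_le_iff]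
    by_cases h1 : -(2 * crit) < a t₁
    · left; linarith [hbad h1]
    · right; linarith
  have hSb : BddBelow S := ⟨0, fun x hx => hx.1.1⟩
  have hmem := hSc.csInf_mem hSne hSb
  set r := sInf S
  have hr0 : 0 ≤ r := hmem.1.1
  have hlt : ∀ t ∈ Ico 0 r, c t < 2 * crit ∧ -(2 * crit) < a t := by
    intro t ht
    have : 0 < m t := by
      by_contra! h'
      exact absurd (csInf_le hSb (show t ∈ S from ⟨⟨ht.1, ht.2.le.trans hmem.1.2⟩, h'⟩))
        (not_le.2 ht.2)
    simp only [hm, lt_min_iff] at this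
    constructor <;> linarith
  have hforce : ∀ t ∈ Ico 0 r, |force ν u t| ≤ 2 / 3 * crit := by
    intro t ht
    refine abs_force_le fun x => abs_cubicForce_le ?_ ?_
    · linarith [hlt t ht, h.a_le x ht.1]
    · linarith [hlt t ht, h.le_c x ht.1]
  -- Both gaps are 1 initially, so the sum is `3 b 0`; hence `c 0 ≤ 1.102 < 2 crit`, and likewise on
  -- the left.
  have hb0 : |b 0| ≤ 0.102 := by
    have h1 := h.sum_le le_rfl
    have h2 := h.le_sum le_rfl
    rw [abs_le]
    constructor <;> linarith [h.gap_left, h.gap_right]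
  rw [abs_le] at hb0
  have hs := lt_crit
  have hs' := crit_lt
  have e := crit_sq
  have e' := crit_cube
  have hc := mul_exp_le_of_deriv_ge (D := fun t => 2 * crit - c t) (K := 4) hr0
    (fun t ht => (h.traj_c t ht).const_sub (2 * crit)) (by
      intro t ht
      obtain ⟨h1, h2⟩ := hlt t ht
      have h3 := (abs_le.1 (hforce t ht)).2
      have h4 : a t < c t := (h.a_lt_b ht.1).trans (h.b_lt_c ht.1)
      have h5 : (c t + crit) ^ 2 ≤ 4 := by nlinarith
      have h6 := mul_le_mul_of_nonneg_left h5 (sub_pos.2 h1).le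
      have h7 : (2 * crit - c t) * (c t + crit) ^ 2
          = 2 * crit ^ 3 + 3 * crit ^ 2 * c t - c t ^ 3 := by ring
      rw [e, e'] at h7
      linarith)
  have ha := mul_exp_le_of_deriv_ge (D := fun t => a t + 2 * crit) (K := 4) hr0
    (fun t ht => (h.traj_a t ht).add_const (2 * crit)) (by
      intro t ht
      obtain ⟨h1, h2⟩ := hlt t ht
      have h3 := (abs_le.1 (hforce t ht)).1
      have h4 : a t < c t := (h.a_lt_b ht.1).trans (h.b_lt_c ht.1)
      have h5 : (a t - crit) ^ 2 ≤ 4 := by nlinarith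
      have h6 := mul_le_mul_of_nonneg_left h5 (show 0 ≤ a t + 2 * crit by linarith)
      have h7 : (a t + 2 * crit) * (a t - crit) ^ 2
          = 2 * crit ^ 3 - 3 * crit ^ 2 * a t + a t ^ 3 := by ring
      rw [e, e'] at h7
      linarith)
  have hc' : 0 < 2 * crit - c r := lt_of_lt_of_le
    (mul_pos (by linarith [h.gap_right]) (Real.exp_pos _)) hc
  have ha' : 0 < a r + 2 * crit := lt_of_lt_of_le
    (mul_pos (by linarith [h.gap_left]) (Real.exp_pos _)) ha
  exact absurd hmem.2 (not_le.2 (lt_min hc' ha'))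

end IsFrame

/-! ### One phase: gap ratio and settling time -/

/-- The data of one phase: a group `K` of points in `E` moving with `x`, which is the next one to
settle, and a group `K'` of points in `O` moving with `x'`, which still stays close to `M`. The
numbers `μ'` and `ρ` bound the mass of `K'` and the ratio of the gaps. -/
structure IsPhase (ν : Measure X) (u : X → ℝ → ℝ) (E O K K' : Set X) (x x' : X) (μ' ρ : ℝ) :
    Prop where
  measurable_K : MeasurableSet K
  measurable_K' : MeasurableSet K'
  K_subset : K ⊆ E
  K'_subset : K' ⊆ O
  x_mem : x ∈ K
  x'_mem : x' ∈ K'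
  on_K : ∀ y ∈ K, u y 0 = u x 0
  on_K' : ∀ y ∈ K', u y 0 = u x' 0
  mass_K : 7.8 * μ' ≤ ν.real K
  mass_K' : 0.98 * μ' ≤ ν.real K'
  mass_E : ν.real E * ρ ≤ 0.51 * μ'
  mass_O : ν.real O * ρ ≤ 0.51 * μ'
  μ'_pos : 0 < μ'
  μ'_le : 5 * μ' ≤ ρ
  ρ_le : ρ ≤ 1 / 16

namespace IsFrame

variable {a b c : ℝ → ℝ} {L M R E O : Set X}

/-- Write `2b = (a + b + c) - c + (b - a)` and use `c < 2 crit`; the constant is just below `(1 -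
0.306) / 2`. -/
theorem le_b_add_crit (h : IsFrame ν u a b c L M R E O) {t : ℝ} (ht : 0 ≤ t) :
    0.345 * (b t - a t) ≤ b t + crit := by
  linarith [h.bounds t ht, h.le_sum ht, h.a_lt_b ht]

theorem le_crit_sub_b (h : IsFrame ν u a b c L M R E O) {t : ℝ} (ht : 0 ≤ t) :
    0.345 * (c t - b t) ≤ crit - b t := by
  linarith [h.bounds t ht, h.sum_le ht, h.b_lt_c ht]

theorem neg_crit_lt_b (h : IsFrame ν u a b c L M R E O) {t : ℝ} (ht : 0 ≤ t) : -crit < b t := by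
  linarith [h.le_b_add_crit ht, h.a_lt_b ht]

theorem b_lt_crit (h : IsFrame ν u a b c L M R E O) {t : ℝ} (ht : 0 ≤ t) : b t < crit := by
  linarith [h.le_crit_sub_b ht, h.b_lt_c ht]

/-- The rate of `c - a` is `1 - 3/4 (a + c)² - 1/4 (c - a)²`. For width below 7/5 the sum bounds
give `|a + c| ≤ 0.8`, and `0.48 + 0.49 < 1`. -/
theorem le_width (h : IsFrame ν u a b c L M R E O) {t : ℝ} (ht : 0 ≤ t) :
    7 / 5 ≤ c t - a t := by
  refine le_of_deriv_nonneg_below (T := t) le_rfl (h.traj_a.hasDeriv_sub h.traj_c)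
    (by linarith [h.gap_left, h.gap_right]) (fun r hr hlt => ?_) t ⟨ht, le_rfl⟩
  have h1 := h.sum_le hr.1
  have h2 := h.le_sum hr.1
  have h3 := h.a_lt_b hr.1
  have h4 := h.b_lt_c hr.1
  have h5 : |a r + c r| ≤ 0.8 := by
    rw [abs_le]; constructor <;> linarith
  have h6 := sq_le_sq' (abs_le.1 h5).1 (abs_le.1 h5).2
  refine mul_nonneg (by linarith) ?_
  nlinarith

/-- The right phase interval is positively invariant. -/
theorem crit_le_of_crit_le (h : IsFrame ν u a b c L M R E O) {x : X} {s t : ℝ} (hs : 0 ≤ s)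
    (hst : s ≤ t) (hx : crit ≤ u x s) : crit ≤ u x t := by
  have htraj := h.sol.isTrajectory x
  -- The barrier is degenerate: at `crit` the velocity is only known to be nonnegative. Below `crit`
  -- it is at least `-(crit - u)²(u + 2 crit) ≥ -3 (crit - u)`, which the exponential weight
  -- absorbs.
  have hder : ∀ r, 0 ≤ r → HasDerivWithinAt (fun r => (u x r - crit) * Real.exp (-3 * r))
      ((u x r - u x r ^ 3 + force ν u r - 3 * (u x r - crit)) * Real.exp (-3 * r)) (Ici 0) r := by
    intro r hr
    have h1 : HasDerivAt (fun r : ℝ => Real.exp (-3 * r)) (Real.exp (-3 * r) * (-3)) r := by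
      simpa using ((hasDerivAt_id r).const_mul (-3)).exp
    refine (((htraj r hr).sub_const crit).mul h1.hasDerivWithinAt).congr_deriv ?_
    ring
  have key := le_of_deriv_nonneg_below (ρ := 0) (T := t) hs hder
    (mul_nonneg (sub_nonneg.2 hx) (Real.exp_pos _).le) (fun r hr hlt => by
      have hr0 : 0 ≤ r := hs.trans hr.1
      have hlt' : u x r - crit < 0 := by
        by_contra! hge
        exact absurd hlt (not_lt.2 (mul_nonneg hge (Real.exp_pos _).le))
      refine mul_nonneg ?_ (Real.exp_pos _).le
      have hlow : -(2 * crit) < u x r := (h.bounds r hr0).1.trans_le (h.a_le x hr0)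
      have hf : |force ν u r| ≤ 2 / 3 * crit := by
        refine abs_force_le fun y => abs_cubicForce_le ?_ ?_
        · linarith [h.bounds r hr0, h.a_le y hr0]
        · linarith [h.bounds r hr0, h.le_c y hr0]
      have hf' := (abs_le.1 hf).1
      have hid : (u x r - crit) ^ 2 * (u x r + 2 * crit)
          = u x r ^ 3 - 3 * crit ^ 2 * u x r + 2 * crit ^ 3 := by ring
      rw [crit_sq, crit_cube] at hid
      have h2 := crit_lt
      have h3 : (crit - u x r) * (u x r + 2 * crit) ≤ 3 := by nlinarith
      nlinarith [mul_le_mul_of_nonneg_left h3 (show 0 ≤ crit - u x r by linarith)]) t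
    ⟨hst, le_rfl⟩
  exact sub_nonneg.1 (nonneg_of_mul_nonneg_left key (Real.exp_pos _))

/-- While the gaps `c - b` and `b - a` are comparable up to the factor `ρ`, they are bounded from
below in terms of `ρ`. -/
theorem gap_bounds {y z ρ : ℝ} (hρ : 0 < ρ) (hρ' : ρ ≤ 1 / 16) (hy : ρ * z ≤ y) (hz : ρ * y ≤ z)
    (hD : 7 / 5 ≤ y + z) : 1.31 * ρ ≤ y ∧ 1.31 * ρ ≤ z ∧ 0.9 * ρ ≤ y * z := by
  have h1 : 1.31 * ρ ≤ y := by nlinarith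
  have h2 : 1.31 * ρ ≤ z := by nlinarith
  refine ⟨h1, h2, ?_⟩
  rcases le_total y z with h | h <;> nlinarith

/-- The growth rate of the distance of an unsettled point to the middle trajectory. -/
theorem le_growth_rate (h : IsFrame ν u a b c L M R E O) {t ρ w : ℝ} (ht : 0 ≤ t) (hρ : 0 < ρ)
    (hρ' : ρ ≤ 1 / 16) (hy : ρ * (b t - a t) ≤ c t - b t) (hz : ρ * (c t - b t) ≤ b t - a t)
    (hbw : b t ≤ w) (hw : w ≤ crit) : ρ / 5 ≤ 1 - (b t ^ 2 + b t * w + w ^ 2) := by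
  obtain ⟨h1, h2, h3⟩ := gap_bounds hρ hρ' hy hz (by linarith [h.le_width ht])
  have e := crit_sq
  have hs := lt_crit
  have hb1 := h.le_b_add_crit ht
  have hb2 := h.le_crit_sub_b ht
  have hba := sub_pos.2 (h.a_lt_b ht)
  have hcb := sub_pos.2 (h.b_lt_c ht)
  -- The rate is concave in `w`, so its minimum over `[b, crit]` is at an endpoint: `(crit - b)(b +
  -- 2 crit)` at `crit`, `3(crit² - b²)` at `b`. The sign of `w + crit + b` tells whether the value
  -- at `crit` is a lower bound.
  rcases le_total 0 (w + crit + b t) with hc | hc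
  · have h4 : 1 - (b t ^ 2 + b t * w + w ^ 2) =
        (crit - b t) * (b t + 2 * crit) + (crit - w) * (w + crit + b t) := by
      linear_combination (-3) * e
    have h5 := mul_nonneg (sub_nonneg.2 hw) hc
    have h6 : 0.345 * (1.31 * ρ) * 0.577 ≤ (crit - b t) * (b t + 2 * crit) := by
      apply mul_le_mul <;> nlinarith
    nlinarith
  · have h4 : 1 - (b t ^ 2 + b t * w + w ^ 2) =
        3 * ((crit - b t) * (b t + crit)) + (w - b t) * (-(w + 2 * b t)) := by
      linear_combination (-3) * e
    have h5 := mul_nonneg (sub_nonneg.2 hbw)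
      (show 0 ≤ -(w + 2 * b t) by linarith [h.b_lt_crit ht])
    have h6 : 0.345 * (c t - b t) * (0.345 * (b t - a t)) ≤ (crit - b t) * (b t + crit) :=
      mul_le_mul hb2 hb1 (by linarith) (by linarith)
    nlinarith

variable {K K' : Set X} {x x' : X} {μ' ρ : ℝ}

theorem le_integral_K (h : IsFrame ν u a b c L M R E O) (hp : IsPhase ν u E O K K' x x' μ' ρ)
    {t : ℝ} (ht : 0 ≤ t) : 7.8 * μ' * (c t - u x t) ≤ ∫ y in E, (c t - u y t) ∂ν :=
  (mul_le_mul_of_nonneg_right hp.mass_K (sub_nonneg.2 (h.le_c x ht))).trans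
    (h.le_integral_E ht hp.measurable_K hp.K_subset fun y hy =>
      ((h.sol.isTrajectory y).eq_of_eq (h.sol.isTrajectory x) (hp.on_K y hy) ht).le)

theorem le_integral_K' (h : IsFrame ν u a b c L M R E O) (hp : IsPhase ν u E O K K' x x' μ' ρ)
    {t : ℝ} (ht : 0 ≤ t) : 0.98 * μ' * (u x' t - a t) ≤ ∫ y in O, (u y t - a t) ∂ν :=
  (mul_le_mul_of_nonneg_right hp.mass_K' (sub_nonneg.2 (h.a_le x' ht))).trans
    (h.le_integral_O ht hp.measurable_K' hp.K'_subset fun y hy =>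
      ((h.sol.isTrajectory y).eq_of_eq (h.sol.isTrajectory x') (hp.on_K' y hy) ht).ge)

/-- As long as `x` is not settled and `x'` is close to `M`, the ratio of the gaps stays bounded. -/
theorem gap_ratio (h : IsFrame ν u a b c L M R E O) (hp : IsPhase ν u E O K K' x x' μ' ρ) {T : ℝ}
    (hclose : ∀ t ∈ Icc 0 T, b t - u x' t ≤ μ') (hun : ∀ t ∈ Icc 0 T, u x t ≤ crit) :
    ∀ t ∈ Icc 0 T, ρ * (b t - a t) ≤ c t - b t ∧ ρ * (c t - b t) ≤ b t - a t := by
  have hμ := hp.μ'_pos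
  have hρ := hp.ρ_le
  have hμρ := hp.μ'_le
  have hs := crit_lt
  intro t ht
  constructor
  · rw [← le_div_iff₀ (sub_pos.2 (h.a_lt_b ht.1))]
    refine le_of_deriv_nonneg_below (T := T) le_rfl
      (fun r hr => h.traj_a.hasDeriv_ratio h.traj_b h.traj_c r hr (h.a_lt_b hr).ne) ?_ ?_ t ht
    · rw [h.gap_left, h.gap_right]; linarith
    · intro r hr hlt
      have hz := sub_pos.2 (h.a_lt_b hr.1)
      have hy := sub_pos.2 (h.b_lt_c hr.1)
      rw [div_lt_iff₀ hz] at hlt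
      refine mul_nonneg (div_nonneg hy.le hz.le) ?_
      have hD := h.le_width hr.1
      -- When `c - b` is relatively small, all of E weighs less than the group `K'` near M, so the
      -- sum is nonpositive and the ratio does not decrease.
      have h1 := h.integral_E_le hr.1
      have h2 := h.le_integral_K' hp hr.1
      have h3 := hclose r hr
      have h4 : 1.3 ≤ b r - a r := by nlinarith
      have h5 : ν.real E * (c r - b r) ≤ 0.51 * μ' * (b r - a r) := by
        calc ν.real E * (c r - b r) ≤ ν.real E * (ρ * (b r - a r)) :=
              mul_le_mul_of_nonneg_left hlt.le measureReal_nonneg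
          _ = ν.real E * ρ * (b r - a r) := by ring
          _ ≤ _ := mul_le_mul_of_nonneg_right hp.mass_E hz.le
      have h6 : 0.51 * μ' * (b r - a r) ≤ 0.98 * μ' * (u x' r - a r) := by
        nlinarith
      have h7 := h.sum_eq hr.1
      have h8 : a r + b r + c r ≤ 0 := by linarith
      nlinarith
  · rw [← le_div_iff₀ (sub_pos.2 (h.b_lt_c ht.1)), ← neg_div_neg_eq, neg_sub, neg_sub]
    refine le_of_deriv_nonneg_below (T := T) le_rfl
      (fun r hr => h.traj_c.hasDeriv_ratio h.traj_b h.traj_a r hr (h.b_lt_c hr).ne') ?_ ?_ t ht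
    · rw [← neg_div_neg_eq, neg_sub, neg_sub, h.gap_left, h.gap_right]; linarith
    · intro r hr hlt
      have hz := sub_pos.2 (h.a_lt_b hr.1)
      have hy := sub_pos.2 (h.b_lt_c hr.1)
      rw [← neg_div_neg_eq, neg_sub, neg_sub] at hlt ⊢
      rw [div_lt_iff₀ hy] at hlt
      refine mul_nonneg (div_nonneg hz.le hy.le) ?_
      have hD := h.le_width hr.1
      have h1 := h.integral_O_le hr.1
      have h2 := h.le_integral_K hp hr.1
      have h3 := hun r hr
      have h4 : 1.3 ≤ c r - b r := by nlinarith
      have h5 : ν.real O * (b r - a r) ≤ 0.51 * μ' * (c r - b r) := by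
        calc ν.real O * (b r - a r) ≤ ν.real O * (ρ * (c r - b r)) :=
              mul_le_mul_of_nonneg_left hlt.le measureReal_nonneg
          _ = ν.real O * ρ * (c r - b r) := by ring
          _ ≤ _ := mul_le_mul_of_nonneg_right hp.mass_O hy.le
      -- Here `c ≥ 2/3 (c - b)`, while `u x ≤ crit < 0.45 (c - b)` because `c - b ≥ 1.3`; so the
      -- unsettled `K` outweighs O.
      have h6 : 0.2 * (c r - b r) ≤ c r - u x r := by linarith [h.le_sum hr.1]
      have h7 : 0.51 * μ' * (c r - b r) ≤ 7.8 * μ' * (c r - u x r) := by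
        nlinarith
      have h8 := h.sum_eq hr.1
      have h9 : 0 ≤ a r + b r + c r := by linarith
      nlinarith

/-- The settling time of one phase. -/
theorem exists_settling_time (h : IsFrame ν u a b c L M R E O)
    (hp : IsPhase ν u E O K K' x x' μ' ρ) {T : ℝ} (hT : 0 ≤ T)
    (hclose : ∀ t ∈ Icc 0 T, b t - u x' t ≤ μ')
    (hlarge : 2 ≤ (u x 0 - b 0) * Real.exp (μ' * T)) (h0 : u x 0 < crit) :
    ∃ τ, 0 < τ ∧ τ ≤ T ∧ (∀ t, 0 ≤ t → t < τ → u x t < crit) ∧ (∀ t, τ ≤ t → crit ≤ u x t) ∧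
      u x τ = crit ∧ ∀ t ∈ Icc 0 τ, ρ * (b t - a t) ≤ c t - b t ∧ ρ * (c t - b t) ≤ b t - a t ∧
        -crit < u x' t := by
  have hμ := hp.μ'_pos
  have hρ := hp.ρ_le
  have hμρ := hp.μ'_le
  have htraj := h.sol.isTrajectory x
  have hxE := hp.K_subset hp.x_mem
  set S := Icc 0 T ∩ u x ⁻¹' Ici crit
  -- Without settling by `T`, the distance from `x` to M grows at rate at least `ρ/5 ≥ μ'` and
  -- reaches 2, more than the width `2 crit` of the middle phase.
  have hSne : S.Nonempty := by
    by_contra hne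
    rw [not_nonempty_iff_eq_empty] at hne
    have hun : ∀ t ∈ Icc 0 T, u x t < crit := by
      intro t ht
      by_contra! hge
      exact (hne ▸ (show t ∈ S from ⟨ht, hge⟩) : t ∈ (∅ : Set ℝ))
    have hgap := h.gap_ratio hp hclose fun t ht => (hun t ht).le
    have hgrow := growth_ge (K := μ') (h.traj_b.hasDeriv_sub htraj)
      (h.traj_b.continuousOn_quad htraj) le_rfl hT (sub_pos.2 (h.b_lt hxE le_rfl)).le
      (fun r hr => le_trans (by linarith) (h.le_growth_rate hr.1 (by linarith) hρ (hgap r hr).1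
        (hgap r hr).2 (h.b_lt hxE hr.1).le (hun r hr).le))
    rw [sub_zero] at hgrow
    linarith [hun T ⟨hT, le_rfl⟩, h.neg_crit_lt_b hT, crit_lt]
  have hcont : ContinuousOn (u x) (Icc 0 T) := htraj.continuousOn.mono Icc_subset_Ici_self
  have hSc : IsClosed S := hcont.preimage_isClosed_of_isClosed isClosed_Icc isClosed_Ici
  have hSb : BddBelow S := ⟨0, fun t ht => ht.1.1⟩
  have hmem := hSc.csInf_mem hSne hSb
  set τ := sInf S
  have hτ0 : 0 < τ := by
    refine lt_of_le_of_ne hmem.1.1 fun h' => ?_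
    have h2 : crit ≤ u x τ := hmem.2
    rw [← h'] at h2
    linarith
  have hbefore : ∀ t, 0 ≤ t → t < τ → u x t < crit := by
    intro t ht htτ
    by_contra! hge
    exact absurd (csInf_le hSb (show t ∈ S from ⟨⟨ht, htτ.le.trans hmem.1.2⟩, hge⟩))
      (not_le.2 htτ)
  have hle : u x τ ≤ crit := by
    have hcl : τ ∈ closure (Ico 0 τ) := by
      rw [closure_Ico hτ0.ne]; exact ⟨hτ0.le, le_rfl⟩
    have hcτ : ContinuousOn (u x) (closure (Ico 0 τ)) := by
      rw [closure_Ico hτ0.ne]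
      exact hcont.mono (Icc_subset_Icc_right hmem.1.2)
    exact closure_minimal (t := Iic crit) (image_subset_iff.2 fun t ht => (hbefore t ht.1 ht.2).le)
      isClosed_Iic (hcτ.image_closure (mem_image_of_mem _ hcl))
  have hsub : Icc 0 τ ⊆ Icc 0 T := Icc_subset_Icc_right hmem.1.2
  have hgap := h.gap_ratio (T := τ) hp (fun t ht => hclose t (hsub ht)) fun t ht => by
    rcases ht.2.lt_or_eq with h' | h'
    · exact (hbefore t ht.1 h').le
    · rw [h']; exact hle
  refine ⟨τ, hτ0, hmem.1.2, hbefore, fun t ht => h.crit_le_of_crit_le hτ0.le ht hmem.2,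
    le_antisymm hle hmem.2, fun t ht => ⟨(hgap t ht).1, (hgap t ht).2, ?_⟩⟩
  -- `b + crit ≥ 0.345 · 1.31 ρ > 2 μ'`, while `x'` is within `μ'` of M; so `x'` has not settled.
  obtain ⟨-, h2, -⟩ := gap_bounds (by linarith) hρ (hgap t ht).1 (hgap t ht).2
    (by linarith [h.le_width ht.1])
  linarith [h.le_b_add_crit ht.1, hclose t (hsub ht)]

/-! ### Long phases: settled points decay and the middle trajectory moves -/

/-- Points that have settled on the left approach the left trajectory exponentially. -/
theorem settled_decay (h : IsFrame ν u a b c L M R E O) {x : X} (hx : x ∈ O) {T t κ ρ μ : ℝ}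
    (hT : 0 ≤ T) (hκ : 0 ≤ κ) (ht : T + κ ≤ t) (hxT : u x T ≤ -crit) (hμ : 0 < μ)
    (hμρ : 5 * μ ≤ ρ) (hρ : ρ ≤ 1 / 16)
    (hgap : ∀ r ∈ Icc 0 t, ρ * (b r - a r) ≤ c r - b r ∧ ρ * (c r - b r) ≤ b r - a r) :
    u x t - a t ≤ 2 * Real.exp (-(μ * κ)) * (b t - a t) := by
  have hTt : T ≤ t := by linarith
  have ht0 : 0 ≤ t := hT.trans hTt
  have htraj := h.sol.isTrajectory x
  have hbu : 0 < b T - u x T := sub_pos.2 (h.lt_b hx hT)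
  -- The ratio `(u x - a)/(b - u x)` has rate `(b - a)(a + b + u x)`; as `u x < b`, this is at most
  -- `-0.694 (b - a)(c - b)`.
  have hq : ∀ r ∈ Icc T t, -((a r - b r) * (b r + u x r + a r)) ≤ -μ := by
    intro r hr
    have hr0 : 0 ≤ r := hT.trans hr.1
    obtain ⟨-, -, h3⟩ := gap_bounds (by linarith) hρ (hgap r ⟨hr0, hr.2⟩).1 (hgap r ⟨hr0, hr.2⟩).2
      (by linarith [h.le_width hr0])
    have h4 : b r + u x r + a r ≤ -(0.694 * (c r - b r)) := by
      linarith [h.sum_le hr0, h.lt_b hx hr0]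
    nlinarith [h.a_lt_b hr0]
  -- Since `u x ≤ -crit`, the distance to `b` is at least `0.345 (b - a)`, more than a third of the
  -- gap.
  have hratio : (a T - u x T) / (u x T - b T) ≤ 2 := by
    rw [← neg_div_neg_eq, neg_sub, neg_sub, div_le_iff₀ hbu]
    linarith [h.le_b_add_crit hT, h.a_lt_b hT]
  have hratio0 : 0 ≤ (a T - u x T) / (u x T - b T) := by
    rw [← neg_div_neg_eq, neg_sub, neg_sub]
    exact div_nonneg (sub_nonneg.2 (h.a_le x hT)) hbu.le
  have hgrow := growth_le (K := -μ)
    (fun r hr => h.traj_b.hasDeriv_ratio htraj h.traj_a r hr (h.lt_b hx hr).ne')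
    (h.traj_b.continuousOn_rate htraj h.traj_a) hT hTt hratio0 hq
  have hexp : Real.exp (-μ * (t - T)) ≤ Real.exp (-(μ * κ)) := by
    apply Real.exp_le_exp.2
    nlinarith
  have hfin : (a t - u x t) / (u x t - b t) ≤ 2 * Real.exp (-(μ * κ)) :=
    hgrow.trans (mul_le_mul hratio hexp (Real.exp_pos _).le (by norm_num))
  rw [← neg_div_neg_eq, neg_sub, neg_sub, div_le_iff₀ (sub_pos.2 (h.lt_b hx ht0))] at hfin
  refine hfin.trans (mul_le_mul_of_nonneg_left ?_ (by positivity))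
  linarith [h.a_le x ht0]

/-- The pull of the set `O` when most of it has settled. -/
theorem integral_O_le_of_settled (h : IsFrame ν u a b c L M R E O) {O' : Set X} {t ε m : ℝ}
    (ht : 0 ≤ t) (hO' : MeasurableSet O') (hO'O : O' ⊆ O) (hε : 0 ≤ ε)
    (hset : ∀ y ∈ O', u y t - a t ≤ ε * (b t - a t)) (hrest : ν.real (O \ O') ≤ m) :
    ∫ y in O, (u y t - a t) ∂ν ≤ (0.102 * ε + m) * (b t - a t) := by
  have hz := (sub_pos.2 (h.a_lt_b ht)).le
  have hi := h.integrable_sub_a ht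
  have hsplit : ∫ y in O, (u y t - a t) ∂ν
      = ∫ y in O', (u y t - a t) ∂ν + ∫ y in O \ O', (u y t - a t) ∂ν := by
    rw [← setIntegral_union disjoint_sdiff_right (h.measurable_O.diff hO') hi.integrableOn
      hi.integrableOn, union_sdiff_cancel hO'O]
  have h1 : ∫ y in O', (u y t - a t) ∂ν ≤ 0.102 * (ε * (b t - a t)) := by
    calc ∫ y in O', (u y t - a t) ∂ν ≤ ∫ _ in O', ε * (b t - a t) ∂ν :=
          setIntegral_mono_on hi.integrableOn (integrable_const _) hO' hset
      _ = ν.real O' * (ε * (b t - a t)) := by rw [setIntegral_const, smul_eq_mul]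
      _ ≤ _ := mul_le_mul_of_nonneg_right ((measureReal_mono hO'O).trans h.mass_O)
          (mul_nonneg hε hz)
  have h2 : ∫ y in O \ O', (u y t - a t) ∂ν ≤ m * (b t - a t) := by
    calc ∫ y in O \ O', (u y t - a t) ∂ν ≤ ∫ _ in O \ O', (b t - a t) ∂ν :=
          setIntegral_mono_on hi.integrableOn (integrable_const _) (h.measurable_O.diff hO')
            fun y hy => by linarith [h.lt_b hy.1 ht]
      _ = ν.real (O \ O') * (b t - a t) := by rw [setIntegral_const, smul_eq_mul]
      _ ≤ _ := mul_le_mul_of_nonneg_right hrest hz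
  rw [hsplit]
  linarith

/-- If the phase is long and the points of `O` from earlier phases have settled at its beginning
`T`, then the middle trajectory moves well to the right of the origin. -/
theorem exists_le_b (h : IsFrame ν u a b c L M R E O) (hp : IsPhase ν u E O K K' x x' μ' ρ)
    {O' : Set X} {T τ κ : ℝ} (hT : 0 ≤ T) (hO' : MeasurableSet O') (hO'O : O' ⊆ O)
    (hset : ∀ y ∈ O', u y T ≤ -crit) (hrest : ν.real (O \ O') ≤ 8 / 7 * μ') (hTτ : T ≤ τ)
    (hκ : κ = 3 / μ' * Real.log (18 / μ'))
    (hgap : ∀ t ∈ Icc 0 τ, ρ * (b t - a t) ≤ c t - b t ∧ ρ * (c t - b t) ≤ b t - a t)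
    (hτ : u x τ = crit) (hclose : ∀ t ∈ Icc 0 (T + 2 * κ), u x t - b t ≤ 1 / 24) :
    ∃ t, 0 ≤ t ∧ (2 * μ' ≤ (u x 0 - b 0) * Real.exp t ∨ κ ≤ t) ∧ 1 / 20 ≤ b t := by
  have hμ := hp.μ'_pos
  have hρ := hp.ρ_le
  have hμρ := hp.μ'_le
  have hτ0 : 0 ≤ τ := hT.trans hTτ
  have hlog : 0 ≤ Real.log (18 / μ') :=
    Real.log_nonneg (by rw [le_div_iff₀ hμ]; linarith)
  have hκ0 : 0 ≤ κ := by rw [hκ]; positivity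
  -- If `x` settles early, then at `τ` it is at `crit` and within 1/24 of M, so `τ` itself serves.
  rcases le_or_gt τ (T + 2 * κ) with hle | hgt
  · refine ⟨τ, hτ0, Or.inl ?_, ?_⟩
    · have h1 := h.traj_b.sub_le_mul_exp (h.sol.isTrajectory x)
        (h.b_lt (hp.K_subset hp.x_mem) le_rfl).le hτ0
      obtain ⟨h2, -, -⟩ := gap_bounds (by linarith) hρ (hgap τ ⟨hτ0, le_rfl⟩).1
        (hgap τ ⟨hτ0, le_rfl⟩).2 (by linarith [h.le_width hτ0])
      linarith [h.le_crit_sub_b hτ0]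
    · linarith [hclose τ ⟨hτ0, hle⟩, lt_crit]
  have hexp : Real.exp (-(μ' * κ)) ≤ μ' / 18 := by
    have h1 : μ' * κ = 3 * Real.log (18 / μ') := by rw [hκ]; field_simp
    calc Real.exp (-(μ' * κ)) ≤ Real.exp (-Real.log (18 / μ')) :=
          Real.exp_le_exp.2 (by linarith)
      _ = μ' / 18 := by rw [Real.exp_neg, Real.exp_log (by positivity), inv_div]
  have hsub : ∀ {t}, t ≤ T + 2 * κ → t ≤ τ := fun ht => ht.trans hgt.le
  -- The first `κ` lets the settled part of O decay. If the ratio stayed above 1/2 during the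
  -- second, O would weigh at most `2.4 μ' (c - b)` against `7 μ' (c - b)` for E, and the ratio
  -- would fall from `1/ρ` to at most `μ'/(18 ρ) ≤ 1/90`.
  obtain ⟨t, ht, hhalf⟩ : ∃ t ∈ Icc (T + κ) (T + 2 * κ),
      (c t - b t) / (b t - a t) ≤ 1 / 2 := by
    by_contra! hcon
    have hTκ : 0 ≤ T + κ := by linarith
    have hq : ∀ r ∈ Icc (T + κ) (T + 2 * κ), -((c r - a r) * (a r + b r + c r)) ≤ -μ' := by
      intro r hr
      have hr0 : 0 ≤ r := hTκ.trans hr.1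
      have hz := sub_pos.2 (h.a_lt_b hr0)
      have hy := sub_pos.2 (h.b_lt_c hr0)
      have h1 := hcon r hr
      rw [lt_div_iff₀ hz] at h1
      have hD := h.le_width hr0
      have hO := h.integral_O_le_of_settled (ε := 2 * Real.exp (-(μ' * κ))) hr0 hO' hO'O
        (by positivity) (fun y hy => h.settled_decay (hO'O hy) hT hκ0 hr.1 (hset y hy) hμ hμρ hρ
          fun r' hr' => hgap r' ⟨hr'.1, hr'.2.trans (hsub hr.2)⟩) hrest
      have hO2 : ∫ y in O, (u y r - a r) ∂ν ≤ 2.4 * μ' * (c r - b r) := by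
        refine hO.trans ?_
        have : 0.102 * (2 * Real.exp (-(μ' * κ))) + 8 / 7 * μ' ≤ 1.2 * μ' := by linarith
        nlinarith
      have hE := h.le_integral_K hp hr0
      have hcl := hclose r ⟨hr0, hr.2⟩
      have hE2 : 7 * μ' * (c r - b r) ≤ ∫ y in E, (c r - u y r) ∂ν := by
        refine le_trans ?_ hE
        nlinarith
      have hsum : 6 * μ' ≤ a r + b r + c r := by
        rw [h.sum_eq hr0]; nlinarith
      nlinarith
    have hz := sub_pos.2 (h.a_lt_b hTκ)
    have hy := sub_pos.2 (h.b_lt_c hTκ)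
    have hstart : (c (T + κ) - b (T + κ)) / (b (T + κ) - a (T + κ)) ≤ 1 / ρ := by
      rw [div_le_div_iff₀ hz (by linarith), mul_comm]
      linarith [(hgap (T + κ) ⟨hTκ, hsub (by linarith)⟩).2]
    have hgrow := growth_le (K := -μ')
      (fun r hr => h.traj_a.hasDeriv_ratio h.traj_b h.traj_c r hr (h.a_lt_b hr).ne)
      (h.traj_a.continuousOn_rate h.traj_b h.traj_c) hTκ
      (show T + κ ≤ T + 2 * κ by linarith) (div_nonneg hy.le hz.le) hq
    have h1 : -μ' * (T + 2 * κ - (T + κ)) = -(μ' * κ) := by ring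
    rw [h1] at hgrow
    have h2 := hcon (T + 2 * κ) ⟨by linarith, le_rfl⟩
    have h3 : 1 / ρ * (μ' / 18) ≤ 1 / 2 := by
      rw [div_mul_div_comm, div_le_div_iff₀ (by linarith) (by norm_num)]
      linarith
    have h4 := mul_le_mul hstart hexp (Real.exp_pos _).le (one_div_nonneg.2 (by linarith))
    linarith
  have ht0 : 0 ≤ t := by linarith [ht.1]
  refine ⟨t, ht0, Or.inr (by linarith [ht.1]), ?_⟩
  -- `3b = (a + b + c) + (b - a) - (c - b) ≥ (1 - 0.306 - 0.5)(b - a)`, and `b - a` is at least two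
  -- thirds of the width.
  rw [div_le_iff₀ (sub_pos.2 (h.a_lt_b ht0))] at hhalf
  linarith [h.le_sum ht0, h.le_width ht0]

end IsFrame
end Solution

/-! ### The piecewise data as frames and phases -/

section Setting

variable {X : Type*} [MeasurableSpace X] {ν : Measure X} [IsProbabilityMeasure ν]
  {μ₀ η θ : ℝ} {α : ℕ → ℝ} {L M R : Set X} {P Z : ℕ → Set X} {v₀ : X → ℝ} {u : X → ℝ → ℝ}

/-- A solution starting from piecewise data with rapidly decreasing heights. -/
structure IsSetting (ν : Measure X) (μ₀ η θ : ℝ) (α : ℕ → ℝ) (L M R : Set X) (P Z : ℕ → Set X)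
    (v₀ : X → ℝ) (u : X → ℝ → ℝ) : Prop where
  μ₀_pos : 0 < μ₀
  μ₀_le : μ₀ ≤ 1 / 10
  η_pos : 0 < η
  η_le : η ≤ 1 / 8
  θ_nonneg : 0 ≤ θ
  θ_le : θ ≤ η ^ 2
  α_pos : ∀ j, 0 < α j
  α_anti : Antitone α
  α_zero : α 0 ≤ 1 / 2
  data : IsPiecewiseData ν μ₀ η θ α L M R P Z v₀
  decay : ∀ j : ℕ, α (j + 1) ≤ mass μ₀ η (j + 1) * (α j / 2) ^ (1 / mass μ₀ η (j + 1))
  sol : IsSolution ν cubicForce u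
  start_eq : ∀ x, u x 0 = v₀ x - ∫ y, v₀ y ∂ν

/-- The union of the pieces whose index has the parity of `k`. -/
def side (P : ℕ → Set X) (k : ℕ) : Set X := ⋃ j, P (2 * j + k % 2)

theorem mem_side {i k : ℕ} {x : X} (hx : x ∈ P i) (h : i % 2 = k % 2) : x ∈ side P k :=
  mem_iUnion.2 ⟨i / 2, by rwa [← h, Nat.div_add_mod]⟩

theorem exists_of_mem_side {k : ℕ} {x : X} (hx : x ∈ side P k) :
    ∃ i, i % 2 = k % 2 ∧ x ∈ P i := by
  obtain ⟨j, hj⟩ := mem_iUnion.1 hx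
  exact ⟨_, by omega, hj⟩

namespace IsSetting

theorem mass_pos (h : IsSetting ν μ₀ η θ α L M R P Z v₀ u)
    (k : ℕ) : 0 < mass μ₀ η k := mul_pos h.μ₀_pos (pow_pos h.η_pos k)

theorem mass_succ_le (h : IsSetting ν μ₀ η θ α L M R P Z v₀ u)
    (k : ℕ) : mass μ₀ η (k + 1) ≤ mass μ₀ η k / 8 := by
  have h1 : mass μ₀ η (k + 1) = mass μ₀ η k * η := by unfold mass; ring
  rw [h1]
  nlinarith [h.mass_pos k, h.η_le]

theorem mass_succ_le_one (h : IsSetting ν μ₀ η θ α L M R P Z v₀ u)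
    (k : ℕ) : mass μ₀ η (k + 1) ≤ 1 / 80 := by
  have h1 : η ^ (k + 1) ≤ 1 / 8 := by
    calc η ^ (k + 1) ≤ η ^ 1 :=
          pow_le_pow_of_le_one h.η_pos.le (by linarith [h.η_le]) (by omega)
      _ ≤ 1 / 8 := by simpa using h.η_le
  unfold mass
  nlinarith [h.μ₀_pos, h.μ₀_le, pow_pos h.η_pos (k + 1)]

theorem θ_small (h : IsSetting ν μ₀ η θ α L M R P Z v₀ u) : θ ≤ 1 / 64 := by
  nlinarith [h.θ_le, h.η_le, h.η_pos]

theorem measureReal_iUnion (h : IsSetting ν μ₀ η θ α L M R P Z v₀ u)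
    {φ : ℕ → ℕ} (hφ : Function.Injective φ) :
    ν.real (⋃ j, P (φ j)) = ∑' j, mass μ₀ η (φ j) := by
  rw [Measure.real, measure_iUnion (fun i j hij => h.data.disjoint_PP (hφ.ne hij))
    (fun j => h.data.measurableSet_P _), ENNReal.tsum_toReal_eq fun j => measure_ne_top _ _]
  exact tsum_congr fun j => h.data.mass_P _

theorem hasSum_side (h : IsSetting ν μ₀ η θ α L M R P Z v₀ u) (r : ℕ) :
    HasSum (fun j => mass μ₀ η (2 * j + r)) (μ₀ * η ^ r * (1 - η ^ 2)⁻¹) := by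
  have h1 : η ^ 2 < 1 := by nlinarith [h.η_le, h.η_pos]
  have h2 := (hasSum_geometric_of_lt_one (sq_nonneg η) h1).mul_left (μ₀ * η ^ r)
  refine h2.congr_fun fun j => ?_
  unfold mass
  rw [pow_add, pow_mul]
  ring

theorem measurableSet_side (h : IsSetting ν μ₀ η θ α L M R P Z v₀ u)
    (k : ℕ) : MeasurableSet (side P k) :=
  MeasurableSet.iUnion fun _ => h.data.measurableSet_P _

theorem real_side (h : IsSetting ν μ₀ η θ α L M R P Z v₀ u)
    (k : ℕ) : ν.real (side P k) = μ₀ * η ^ (k % 2) * (1 - η ^ 2)⁻¹ := by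
  rw [side, h.measureReal_iUnion (φ := fun j => 2 * j + k % 2) (fun i j hij => by simpa using hij)]
  exact (h.hasSum_side _).tsum_eq

theorem inv_le (h : IsSetting ν μ₀ η θ α L M R P Z v₀ u) : (1 - η ^ 2)⁻¹ ≤ 64 / 63 := by
  rw [inv_le_comm₀ (by nlinarith [h.η_le, h.η_pos]) (by norm_num)]
  nlinarith [h.η_le, h.η_pos]

theorem real_side_le (h : IsSetting ν μ₀ η θ α L M R P Z v₀ u)
    (k : ℕ) : ν.real (side P k) ≤ 64 / 63 * μ₀ := by
  rw [h.real_side]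
  have h1 := h.inv_le
  have h2 : η ^ (k % 2) ≤ 1 := pow_le_one₀ h.η_pos.le (by linarith [h.η_le])
  have h3 : 0 ≤ (1 - η ^ 2)⁻¹ := inv_nonneg.2 (by nlinarith [h.η_le, h.η_pos])
  calc μ₀ * η ^ (k % 2) * (1 - η ^ 2)⁻¹ ≤ μ₀ * 1 * (64 / 63) := by
        have := h.μ₀_pos
        gcongr
    _ = _ := by ring

theorem real_tail_le (h : IsSetting ν μ₀ η θ α L M R P Z v₀ u)
    (k : ℕ) : ν.real (⋃ j, P (k + j)) ≤ 8 / 7 * mass μ₀ η k := by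
  rw [h.measureReal_iUnion (φ := fun j => k + j) (fun i j hij => by simpa using hij)]
  have h1 := (hasSum_geometric_of_lt_one h.η_pos.le (by linarith [h.η_le])).mul_left
    (mass μ₀ η k)
  have h2 : ∑' j, mass μ₀ η (k + j) = mass μ₀ η k * (1 - η)⁻¹ := by
    rw [← h1.tsum_eq]
    refine tsum_congr fun j => ?_
    unfold mass
    rw [pow_add]
    ring
  have h3 : (1 - η)⁻¹ ≤ 8 / 7 := by
    rw [inv_le_comm₀ (by linarith [h.η_le]) (by norm_num)]
    linarith [h.η_le]
  rw [h2]
  nlinarith [h.mass_pos k]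

theorem real_core (h : IsSetting ν μ₀ η θ α L M R P Z v₀ u)
    (k : ℕ) : ν.real (P k \ Z k) = (1 - θ) * mass μ₀ η k := by
  rw [measureReal_sdiff (h.data.subset_P k) (h.data.measurableSet_Z k), h.data.mass_P,
    h.data.mass_Z]
  ring

theorem core_nonempty (h : IsSetting ν μ₀ η θ α L M R P Z v₀ u) (k : ℕ) : (P k \ Z k).Nonempty := by
  refine nonempty_of_measureReal_ne_zero (μ := ν) ?_
  rw [h.real_core]
  exact (mul_pos (by linarith [h.θ_small]) (h.mass_pos k)).ne'

theorem α_le_half (h : IsSetting ν μ₀ η θ α L M R P Z v₀ u)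
    (k : ℕ) : α k ≤ 1 / 2 := (h.α_anti (Nat.zero_le k)).trans h.α_zero

theorem bounds_on_P (h : IsSetting ν μ₀ η θ α L M R P Z v₀ u) {k : ℕ} {x : X} (hx : x ∈ P k) :
    α k ≤ (-1) ^ k * v₀ x ∧ (-1) ^ k * v₀ x ≤ 1 := by
  by_cases hZ : x ∈ Z k
  · obtain ⟨h1, h2⟩ := h.data.value_Z k x hZ
    refine ⟨h1, h2.trans ?_⟩
    match k with
    | 0 => exact le_rfl
    | 1 => exact le_rfl
    | k + 2 => exact (h.α_le_half k).trans (by norm_num)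
  · rw [h.data.value_P k x ⟨hx, hZ⟩, ← mul_assoc, ← mul_pow]
    simpa using (h.α_le_half k).trans (by norm_num)

theorem v_mem (h : IsSetting ν μ₀ η θ α L M R P Z v₀ u) (x : X) : -1 ≤ v₀ x ∧ v₀ x ≤ 1 := by
  have hx : x ∈ L ∪ M ∪ R ∪ (⋃ j, P j) := h.data.cover ▸ mem_univ x
  rcases hx with ((hx | hx) | hx) | hx
  · rw [h.data.value_L x hx]; norm_num
  · rw [h.data.value_M x hx]; norm_num
  · rw [h.data.value_R x hx]; norm_num
  · obtain ⟨j, hj⟩ := mem_iUnion.1 hx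
    obtain ⟨h1, h2⟩ := h.bounds_on_P hj
    have h3 := h.α_pos j
    rcases neg_one_pow_eq_or ℝ j with h4 | h4 <;> rw [h4] at h1 h2 <;>
      constructor <;> linarith

theorem integrable_v (h : IsSetting ν μ₀ η θ α L M R P Z v₀ u) : Integrable v₀ ν :=
  Integrable.of_bound h.data.measurable_v.aestronglyMeasurable 1
    (Eventually.of_forall fun x => abs_le.2 (h.v_mem x))

theorem iUnion_eq_sides : ⋃ j, P j = side P 0 ∪ side P 1 := by
  ext x
  constructor
  · intro hx
    obtain ⟨j, hj⟩ := mem_iUnion.1 hx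
    rcases Nat.mod_two_eq_zero_or_one j with h0 | h0
    · exact Or.inl (mem_side hj h0)
    · exact Or.inr (mem_side hj h0)
  · rintro (hx | hx) <;> obtain ⟨i, -, hi⟩ := exists_of_mem_side hx <;>
      exact mem_iUnion.2 ⟨i, hi⟩

theorem L_nonempty (h : IsSetting ν μ₀ η θ α L M R P Z v₀ u) : L.Nonempty := by
  refine nonempty_of_measureReal_ne_zero (μ := ν) ?_
  have h1 := h.real_side_le 1
  rw [side, h.measureReal_iUnion (φ := fun j => 2 * j + 1 % 2)
    (fun i j hij => by simpa using hij)] at h1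
  rw [h.data.mass_L]
  have := h.μ₀_le
  norm_num at h1
  linarith

theorem R_nonempty (h : IsSetting ν μ₀ η θ α L M R P Z v₀ u) : R.Nonempty := by
  refine nonempty_of_measureReal_ne_zero (μ := ν) ?_
  have h1 := h.real_side_le 0
  rw [side, h.measureReal_iUnion (φ := fun j => 2 * j + 0 % 2)
    (fun i j hij => by simpa using hij)] at h1
  rw [h.data.mass_R]
  have := h.μ₀_le
  norm_num at h1
  linarith

theorem M_nonempty (h : IsSetting ν μ₀ η θ α L M R P Z v₀ u) : M.Nonempty := by
  refine nonempty_of_measureReal_ne_zero (μ := ν) ?_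
  rw [h.data.mass_M]
  norm_num

theorem isFrame (h : IsSetting ν μ₀ η θ α L M R P Z v₀ u)
    {l m r : X} (hl : l ∈ L) (hm : m ∈ M) (hr : r ∈ R) :
    IsFrame ν u (u l) (u m) (u r) L M R (side P 0) (side P 1) where
  sol := h.sol
  mean := by
    simp only [h.start_eq]
    rw [integral_sub h.integrable_v (integrable_const _)]
    simp
  split k hk := by
    have hd := h.data
    have hi : ∀ S, IntegrableOn k S ν := fun S => hk.integrableOn
    have hside : ∀ {S : Set X} (n : ℕ), (∀ j, Disjoint S (P j)) → Disjoint S (side P n) :=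
      fun n hS => disjoint_iUnion_right.2 fun j => hS _
    have h01 : Disjoint (side P 0) (side P 1) := by
      rw [Set.disjoint_left]
      intro x h0 h1
      obtain ⟨i, hi, hxi⟩ := exists_of_mem_side h0
      obtain ⟨j, hj, hxj⟩ := exists_of_mem_side h1
      exact (Set.disjoint_left.1 (hd.disjoint_PP (show i ≠ j by omega)) hxi) hxj
    rw [← setIntegral_univ, ← hd.cover, iUnion_eq_sides, ← union_assoc,
      setIntegral_union _ (h.measurableSet_side 1) (hi _) (hi _),
      setIntegral_union _ (h.measurableSet_side 0) (hi _) (hi _),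
      setIntegral_union _ hd.measurableSet_R (hi _) (hi _),
      setIntegral_union hd.disjoint_LM hd.measurableSet_M (hi _) (hi _)]
    · exact hd.disjoint_LR.union_left hd.disjoint_MR
    · exact ((hside 0 hd.disjoint_LP).union_left (hside 0 hd.disjoint_MP)).union_left
        (hside 0 hd.disjoint_RP)
    · exact (((hside 1 hd.disjoint_LP).union_left (hside 1 hd.disjoint_MP)).union_left
        (hside 1 hd.disjoint_RP)).union_left h01
  measurable_L := h.data.measurableSet_L
  measurable_M := h.data.measurableSet_M
  measurable_R := h.data.measurableSet_R
  measurable_E := h.measurableSet_side 0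
  measurable_O := h.measurableSet_side 1
  traj_a := h.sol.isTrajectory l
  traj_b := h.sol.isTrajectory m
  traj_c := h.sol.isTrajectory r
  on_L x hx := by rw [h.start_eq, h.start_eq, h.data.value_L x hx, h.data.value_L l hl]
  on_M x hx := by rw [h.start_eq, h.start_eq, h.data.value_M x hx, h.data.value_M m hm]
  on_R x hx := by rw [h.start_eq, h.start_eq, h.data.value_R x hx, h.data.value_R r hr]
  on_E x hx := by
    obtain ⟨i, hi, hxi⟩ := exists_of_mem_side hx
    have h1 := (h.bounds_on_P hxi).1
    rw [(Nat.even_iff.2 hi).neg_one_pow, one_mul] at h1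
    rw [h.start_eq, h.start_eq, h.data.value_M m hm]
    linarith [h.α_pos i]
  on_O x hx := by
    obtain ⟨i, hi, hxi⟩ := exists_of_mem_side hx
    have h1 := (h.bounds_on_P hxi).1
    rw [(Nat.odd_iff.2 hi).neg_one_pow] at h1
    rw [h.start_eq, h.start_eq, h.data.value_M m hm]
    linarith [h.α_pos i]
  range x := by
    rw [h.start_eq, h.start_eq, h.start_eq, h.data.value_L l hl, h.data.value_R r hr]
    constructor <;> linarith [h.v_mem x]
  gap_left := by rw [h.start_eq, h.start_eq, h.data.value_L l hl, h.data.value_M m hm]; ring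
  gap_right := by rw [h.start_eq, h.start_eq, h.data.value_R r hr, h.data.value_M m hm]; ring
  mass_M := h.data.mass_M
  mass_LO := by
    rw [h.data.mass_L, side, h.measureReal_iUnion (φ := fun j => 2 * j + 1 % 2)
      (fun i j hij => by simpa using hij)]
    norm_num
  mass_RE := by
    rw [h.data.mass_R, side, h.measureReal_iUnion (φ := fun j => 2 * j + 0 % 2)
      (fun i j hij => by simpa using hij)]
    norm_num
  mass_E := (h.real_side_le 0).trans (by linarith [h.μ₀_le])
  mass_O := (h.real_side_le 1).trans (by linarith [h.μ₀_le])

/-- The frame in which the pieces with the parity of `k` lie on the right. -/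
theorem exists_frame (h : IsSetting ν μ₀ η θ α L M R P Z v₀ u)
    {m : X} (hm : m ∈ M) (k : ℕ) : ∃ (a c : ℝ → ℝ) (L' R' : Set X),
    IsFrame ν (fun x t => (-1) ^ k * u x t) a (fun t => (-1) ^ k * u m t) c L' M R'
      (side P k) (side P (k + 1)) := by
  obtain ⟨l, hl⟩ := h.L_nonempty
  obtain ⟨r, hr⟩ := h.R_nonempty
  have hf := h.isFrame hl hm hr
  have hside : ∀ i j, i % 2 = j % 2 → side P i = side P j := fun i j hij => by
    rw [side, side, hij]
  rcases Nat.even_or_odd k with hk | hk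
  · rw [hk.neg_one_pow, hside k 0 (Nat.even_iff.1 hk),
      hside (k + 1) 1 (by have := Nat.even_iff.1 hk; omega)]
    simp only [one_mul]
    exact ⟨_, _, _, _, hf⟩
  · rw [hk.neg_one_pow, hside k 1 (Nat.odd_iff.1 hk),
      hside (k + 1) 0 (by have := Nat.odd_iff.1 hk; omega)]
    simp only [neg_one_mul]
    exact ⟨_, _, _, _, hf.neg⟩

/-- From `η ≤ 1/8` and `θ ≤ 1/64` the core of piece `k` has mass at least `63/64 · 8 μ_{k+1}`. Each
side has mass at most `64/63 μ₀`, which fixes the scale `ρ = η^(k+1)/2`; then `5 μ_{k+1} ≤ ρ` is `μ₀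
≤ 1/10`. -/
theorem isPhase (h : IsSetting ν μ₀ η θ α L M R P Z v₀ u)
    (k : ℕ) {x x' : X} (hx : x ∈ P k \ Z k) (hx' : x' ∈ P (k + 1) \ Z (k + 1)) :
    IsPhase ν (fun x t => (-1) ^ k * u x t) (side P k) (side P (k + 1)) (P k \ Z k)
      (P (k + 1) \ Z (k + 1)) x x' (mass μ₀ η (k + 1)) (η ^ (k + 1) / 2) where
  measurable_K := (h.data.measurableSet_P _).diff (h.data.measurableSet_Z _)
  measurable_K' := (h.data.measurableSet_P _).diff (h.data.measurableSet_Z _)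
  K_subset y hy := mem_side hy.1 rfl
  K'_subset y hy := mem_side hy.1 rfl
  x_mem := hx
  x'_mem := hx'
  on_K y hy := by rw [h.start_eq, h.start_eq, h.data.value_P k y hy, h.data.value_P k x hx]
  on_K' y hy := by
    rw [h.start_eq, h.start_eq, h.data.value_P _ y hy, h.data.value_P _ x' hx']
  mass_K := by
    rw [h.real_core]
    nlinarith [h.mass_succ_le k, h.mass_pos k, h.θ_small]
  mass_K' := by
    rw [h.real_core]
    nlinarith [h.mass_pos (k + 1), h.θ_small]
  mass_E := by
    have h1 := h.real_side_le k
    have h2 := pow_pos h.η_pos (k + 1)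
    unfold mass
    nlinarith [mul_pos h.μ₀_pos h2]
  mass_O := by
    have h1 := h.real_side_le (k + 1)
    have h2 := pow_pos h.η_pos (k + 1)
    unfold mass
    nlinarith [mul_pos h.μ₀_pos h2]
  μ'_pos := h.mass_pos _
  μ'_le := by
    have h2 := pow_pos h.η_pos (k + 1)
    unfold mass
    nlinarith [h.μ₀_le]
  ρ_le := by
    have h1 : η ^ (k + 1) ≤ η ^ 1 :=
      pow_le_pow_of_le_one h.η_pos.le (by linarith [h.η_le]) (by omega)
    linarith [h.η_le, pow_one η]

end IsSetting

/-! ### Transition times, oscillation and the successive phases -/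

theorem exp_log_div {A μ : ℝ} (hA : 0 < A) :
    Real.exp (Real.log (2 / A) / μ) = (A / 2) ^ (-(1 / μ)) := by
  rw [Real.rpow_def_of_pos (by positivity), show Real.log (2 / A) = -Real.log (A / 2) by
    rw [← Real.log_inv, inv_div]]
  congr 1
  ring

theorem two_div_crit : 2 / √3 = 2 * crit := by unfold crit; ring

/-- A sign change does not affect transition times. -/
theorem isTransitionTime_of_sign {w : ℝ → ℝ} {s τ : ℝ} (hs : s = 1 ∨ s = -1) (hτ : 0 < τ)
    (hmid : ∀ t, 0 ≤ t → t < τ → -crit < s * w t ∧ s * w t < crit)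
    (hend : ∀ t, τ ≤ t → crit ≤ s * w t ∧ s * w t ≤ 2 * crit) :
    IsTransitionTime w (τ : EReal) := by
  refine ⟨by exact_mod_cast hτ, fun t ht => ⟨fun h => ?_, fun h => ?_⟩⟩
  · obtain ⟨h1, h2⟩ := hmid t ht (by exact_mod_cast h)
    change -crit < w t ∧ w t < crit
    rcases hs with rfl | rfl <;> constructor <;> linarith
  · obtain ⟨h1, h2⟩ := hend t (by exact_mod_cast h)
    unfold leftPhase rightPhase
    rw [two_div_crit]
    rcases hs with rfl | rfl
    · right; change crit ≤ w t ∧ _; constructor <;> linarith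
    · left; change _ ∧ w t ≤ -crit; constructor <;> linarith

/-- A solution whose values on a set of positive measure oscillate does not converge. -/
theorem not_tendsto_of_oscillation {b : ℝ → ℝ} {δ : ℝ} (hδ : 0 < δ) (hM : MeasurableSet M)
    (hνM : ν M ≠ 0) (hu : ∀ t, 0 ≤ t → Measurable fun x => u x t)
    (hb : ∀ x ∈ M, ∀ t, 0 ≤ t → u x t = b t)
    (hpos : ∀ A, ∃ t, 0 ≤ t ∧ A ≤ t ∧ δ ≤ b t) (hneg : ∀ A, ∃ t, 0 ≤ t ∧ A ≤ t ∧ b t ≤ -δ)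
    {p : ENNReal} (hp : 1 ≤ p) :
    ¬ ∃ w : X → ℝ, MemLp w p ν ∧
      Tendsto (fun t : ℝ => eLpNorm (fun x => u x t - w x) p ν) atTop (𝓝 0) := by
  rintro ⟨w, hw, hlim⟩
  have hp0 : p ≠ 0 := (zero_lt_one.trans_le hp).ne'
  have hres : ν.restrict M ≠ 0 := by rwa [Ne, Measure.restrict_eq_zero]
  set ε : ENNReal := eLpNorm (fun _ : X => δ) p (ν.restrict M) with hε
  have hε0 : 0 < ε := by
    rw [hε, pos_iff_ne_zero, Ne, eLpNorm_eq_zero_iff aestronglyMeasurable_const hp0]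
    intro h0
    have : ∀ᵐ _ ∂(ν.restrict M), False := h0.mono fun x hx => hδ.ne' hx
    rw [eventually_false_iff_eq_bot, ae_eq_bot] at this
    exact hres this
  obtain ⟨A, hA⟩ := eventually_atTop.1 (hlim.eventually_lt_const (ENNReal.half_pos hε0.ne'))
  obtain ⟨s, hs0, hsA, hs⟩ := hpos A
  obtain ⟨t, ht0, htA, ht⟩ := hneg A
  -- On M the values at the two times differ by at least `2δ`, yet both are within `ε/2` of `w` in
  -- norm.
  have hle : ε ≤ eLpNorm (fun x => (u x s - w x) - (u x t - w x)) p (ν.restrict M) := by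
    refine eLpNorm_mono_ae ?_
    filter_upwards [ae_restrict_mem hM] with x hx
    rw [sub_sub_sub_cancel_right, hb x hx s hs0, hb x hx t ht0, Real.norm_eq_abs,
      Real.norm_eq_abs, abs_of_pos hδ]
    exact le_trans (by linarith) (le_abs_self _)
  have hmeas : ∀ r, 0 ≤ r → AEStronglyMeasurable (fun x => u x r - w x) (ν.restrict M) :=
    fun r hr => ((hu r hr).aestronglyMeasurable.sub hw.1).restrict
  have hlt : ∀ r, A ≤ r → eLpNorm (fun x => u x r - w x) p (ν.restrict M) < ε / 2 :=
    fun r hr => (eLpNorm_mono_measure _ Measure.restrict_le_self).trans_lt (hA r hr)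
  have h1 := (hle.trans (eLpNorm_sub_le (hmeas s hs0) (hmeas t ht0) hp)).trans_lt
    (ENNReal.add_lt_add (hlt s hsA) (hlt t htA))
  rw [ENNReal.add_halves] at h1
  exact lt_irrefl _ h1

namespace IsSetting

theorem sign_start (h : IsSetting ν μ₀ η θ α L M R P Z v₀ u) {m : X} (hm : m ∈ M) (x : X) (k : ℕ) :
    (-1) ^ k * u x 0 = (-1) ^ k * v₀ x + (-1) ^ k * u m 0 := by
  rw [h.start_eq, h.start_eq, h.data.value_M m hm]; ring

theorem sign_core (h : IsSetting ν μ₀ η θ α L M R P Z v₀ u)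
    {k : ℕ} {x : X} (hx : x ∈ P k \ Z k) : (-1) ^ k * v₀ x = α k := by
  rw [h.data.value_P k x hx, ← mul_assoc, ← mul_pow]; simp

theorem α_succ_le (h : IsSetting ν μ₀ η θ α L M R P Z v₀ u)
    (k : ℕ) : α (k + 1) ≤ mass μ₀ η (k + 1) := by
  refine (h.decay k).trans (mul_le_of_le_one_right (h.mass_pos _).le ?_)
  exact Real.rpow_le_one (by linarith [h.α_pos k]) (by linarith [h.α_le_half k])
    (one_div_nonneg.2 (h.mass_pos _).le)

/-- Points of the piece `k` start in the middle phase. -/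
theorem start_lt_crit (h : IsSetting ν μ₀ η θ α L M R P Z v₀ u)
    {m : X} (hm : m ∈ M) {k : ℕ} {x : X} (hx : x ∈ P k \ Z k) :
    (-1) ^ k * u x 0 < crit := by
  obtain ⟨l, hl⟩ := h.L_nonempty
  obtain ⟨r, hr⟩ := h.R_nonempty
  have hf := h.isFrame hl hm hr
  have hs := lt_crit
  rw [h.sign_start hm, h.sign_core hx]
  match k with
  -- The general bound `b ≤ 0.102` is too weak when the height is 1/2. But P 0 itself lies `1 - α 0`
  -- below R and carries almost all of its side, so `b ≤ 0.102 (1 - α 0) + 0.002`.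
  | 0 =>
    have hdiff : ν.real (side P 0 \ P 0) ≤ 0.002 := by
      have hsub : P 0 ⊆ side P 0 := fun y hy => mem_side hy rfl
      rw [measureReal_sdiff hsub (h.data.measurableSet_P 0), h.real_side, h.data.mass_P]
      have := h.inv_le
      have := h.μ₀_pos
      unfold mass
      norm_num
      nlinarith [h.μ₀_le]
    have h1 := hf.neg.integral_O_le_of_settled (O' := P 0) (ε := 1 - α 0) le_rfl
      (h.data.measurableSet_P 0) (fun y hy => mem_side hy rfl) (by linarith [h.α_le_half 0])
      (fun y hy => by
        have h2 := (h.bounds_on_P hy).1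
        have h3 := h.start_eq y
        have h4 := h.start_eq m
        rw [h.data.value_M m hm] at h4
        simp only [pow_zero, one_mul] at h2
        have h5 := hf.gap_right
        have h6 : -u m 0 - -u r 0 = 1 := by linarith
        rw [h6]
        linarith) hdiff
    have h2 := hf.sum_eq le_rfl
    have h3 := hf.integral_O_nonneg le_rfl
    have h4 : ∫ y in side P 0, (-u y 0 - -u r 0) ∂ν = ∫ y in side P 0, (u r 0 - u y 0) ∂ν := by
      congr 1; ext y; ring
    rw [h4] at h1
    have h5 := hf.gap_right
    have h6 := hf.gap_left
    have h7 : -u m 0 - -u r 0 = 1 := by linarith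
    rw [h7] at h1
    have := h.α_le_half 0
    simp only [pow_zero, one_mul]
    linarith
  | k + 1 =>
    have h1 := h.α_succ_le k
    have h2 := h.mass_succ_le_one k
    have h3 := hf.sum_le le_rfl
    have h4 := hf.le_sum le_rfl
    have h5 := hf.gap_right
    have h6 := hf.gap_left
    rcases neg_one_pow_eq_or ℝ (k + 1) with h7 | h7 <;> rw [h7] <;> linarith

/-- The settling time of each piece. -/
theorem exists_settling (h : IsSetting ν μ₀ η θ α L M R P Z v₀ u)
    {m : X} (hm : m ∈ M) {r : ℕ → X} (hr : ∀ k, r k ∈ P k \ Z k) (k : ℕ) :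
    ∃ (a c : ℝ → ℝ) (L' R' : Set X) (τ : ℝ),
      IsFrame ν (fun x t => (-1) ^ k * u x t) a (fun t => (-1) ^ k * u m t) c L' M R'
        (side P k) (side P (k + 1)) ∧
      0 < τ ∧ τ ≤ Real.log (2 / α k) / mass μ₀ η (k + 1) ∧
      (∀ t, 0 ≤ t → t < τ → (-1) ^ k * u (r k) t < crit) ∧
      (∀ t, τ ≤ t → crit ≤ (-1) ^ k * u (r k) t) ∧ (-1) ^ k * u (r k) τ = crit ∧
      ∀ t ∈ Icc 0 τ, η ^ (k + 1) / 2 * ((-1) ^ k * u m t - a t) ≤ c t - (-1) ^ k * u m t ∧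
        η ^ (k + 1) / 2 * (c t - (-1) ^ k * u m t) ≤ (-1) ^ k * u m t - a t ∧
        -crit < (-1) ^ k * u (r (k + 1)) t := by
  obtain ⟨a, c, L', R', hf⟩ := h.exists_frame hm k
  have hμ := h.mass_pos (k + 1)
  have hα := h.α_pos k
  refine ⟨a, c, L', R', ?_⟩
  have hT : 0 ≤ Real.log (2 / α k) / mass μ₀ η (k + 1) :=
    div_nonneg (Real.log_nonneg (by rw [le_div_iff₀ hα]; linarith [h.α_le_half k])) hμ.le
  have hk := h.sign_start hm (r k) k
  have hk' := h.sign_start hm (r (k + 1)) k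
  rw [h.sign_core (hr k)] at hk
  have hk1 : (-1) ^ k * v₀ (r (k + 1)) = -α (k + 1) := by
    rw [← h.sign_core (hr (k + 1)), pow_succ]; ring
  rw [hk1] at hk'
  -- At the deadline `exp t` equals `(α k / 2)^(-1/μ_{k+1})`, which exactly cancels the power in the
  -- decay condition.
  have hclose : ∀ t ∈ Icc 0 (Real.log (2 / α k) / mass μ₀ η (k + 1)),
      (-1) ^ k * u m t - (-1) ^ k * u (r (k + 1)) t ≤ mass μ₀ η (k + 1) := by
    intro t ht
    have h2 := (hf.sol.isTrajectory (r (k + 1))).sub_le_mul_exp hf.traj_b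
      (by linarith [h.α_pos (k + 1)]) ht.1
    simp only [hk'] at h2
    have h3 : Real.exp t ≤ (α k / 2) ^ (-(1 / mass μ₀ η (k + 1))) := by
      rw [← exp_log_div hα]
      exact Real.exp_le_exp.2 ht.2
    have h4 : (α k / 2) ^ (1 / mass μ₀ η (k + 1)) * (α k / 2) ^ (-(1 / mass μ₀ η (k + 1))) = 1 := by
      rw [← Real.rpow_add (by positivity)]; simp
    calc _ ≤ _ := h2
      _ = α (k + 1) * Real.exp t := by ring
      _ ≤ mass μ₀ η (k + 1) * (α k / 2) ^ (1 / mass μ₀ η (k + 1)) *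
          (α k / 2) ^ (-(1 / mass μ₀ η (k + 1))) :=
        mul_le_mul (h.decay k) h3 (Real.exp_pos _).le (mul_nonneg hμ.le (by positivity))
      _ = _ := by rw [mul_assoc, h4, mul_one]
  have hlarge : 2 ≤ ((-1) ^ k * u (r k) 0 - (-1) ^ k * u m 0) *
      Real.exp (mass μ₀ η (k + 1) * (Real.log (2 / α k) / mass μ₀ η (k + 1))) := by
    rw [mul_div_cancel₀ _ hμ.ne', Real.exp_log (by positivity), hk]
    rw [add_sub_cancel_right, mul_div_cancel₀ _ hα.ne']
  obtain ⟨τ, h1⟩ := hf.exists_settling_time (h.isPhase k (hr k) (hr (k + 1))) hT hclose hlarge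
    (h.start_lt_crit hm (hr k))
  exact ⟨τ, hf, h1⟩

/-- Late in a long phase the middle trajectory is away from the origin. -/
theorem exists_late (h : IsSetting ν μ₀ η θ α L M R P Z v₀ u)
    {m : X} (hm : m ∈ M) {r : ℕ → X} (hr : ∀ k, r k ∈ P k \ Z k) {τ : ℕ → ℝ}
    (hτ0 : ∀ k, 0 < τ k) (hτmono : StrictMono τ)
    (hτexp : ∀ k, Real.exp (τ k) ≤ (α k / 2) ^ (-(1 / mass μ₀ η (k + 1))))
    (hset : ∀ k t, τ k ≤ t → crit ≤ (-1) ^ k * u (r k) t) {k : ℕ} {a c : ℝ → ℝ} {L' R' : Set X}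
    (hf : IsFrame ν (fun x t => (-1) ^ (k + 1) * u x t) a (fun t => (-1) ^ (k + 1) * u m t) c
      L' M R' (side P (k + 1)) (side P (k + 1 + 1)))
    (hτ : (-1) ^ (k + 1) * u (r (k + 1)) (τ (k + 1)) = crit)
    (hgap : ∀ t ∈ Icc 0 (τ (k + 1)),
      η ^ (k + 1 + 1) / 2 * ((-1) ^ (k + 1) * u m t - a t) ≤ c t - (-1) ^ (k + 1) * u m t ∧
      η ^ (k + 1 + 1) / 2 * (c t - (-1) ^ (k + 1) * u m t) ≤ (-1) ^ (k + 1) * u m t - a t)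
    (hα : α (k + 1) ≤ 1 / 24 * (α k / 2) ^ (1 / mass μ₀ η (k + 1)) *
      Real.exp (-2 * kappa μ₀ η (k + 1))) :
    ∃ t, 0 ≤ t ∧ 1 / mass μ₀ η (k + 2) ≤ Real.exp t ∧ 1 / 20 ≤ (-1) ^ (k + 1) * u m t := by
  have hμ := h.mass_pos (k + 2)
  have hμ1 := h.mass_succ_le_one (k + 1)
  have hαk := h.α_pos k
  have hk := h.sign_start hm (r (k + 1)) (k + 1)
  rw [h.sign_core (hr (k + 1))] at hk
  have hrp := Real.rpow_pos_of_pos (half_pos hαk) (1 / mass μ₀ η (k + 1))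
  have hinv : (α k / 2) ^ (1 / mass μ₀ η (k + 1)) * (α k / 2) ^ (-(1 / mass μ₀ η (k + 1))) = 1 := by
    rw [← Real.rpow_add (by positivity)]; simp
  set κ := kappa μ₀ η (k + 1) with hκ
  have hκlog : Real.log (18 / mass μ₀ η (k + 2)) ≤ κ := by
    rw [hκ, kappa]
    refine le_mul_of_one_le_left (Real.log_nonneg ?_) ?_
    · rw [le_div_iff₀ hμ]; linarith
    · rw [le_div_iff₀ hμ]; linarith
  have hκexp : 18 / mass μ₀ η (k + 2) ≤ Real.exp κ := by
    rw [← Real.log_le_iff_le_exp (by positivity)]; exact hκlog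
  -- The factor `exp (-2κ)` in the stronger decay condition pays for the extra time `2κ` after `τ
  -- k`.
  have hclose : ∀ t ∈ Icc 0 (τ k + 2 * κ),
      (-1) ^ (k + 1) * u (r (k + 1)) t - (-1) ^ (k + 1) * u m t ≤ 1 / 24 := by
    intro t ht
    have h2 := hf.traj_b.sub_le_mul_exp (hf.sol.isTrajectory (r (k + 1)))
      (by linarith [h.α_pos (k + 1)]) ht.1
    simp only [hk, add_sub_cancel_right] at h2
    calc _ ≤ _ := h2
      _ ≤ (1 / 24 * (α k / 2) ^ (1 / mass μ₀ η (k + 1)) * Real.exp (-2 * κ)) *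
          ((α k / 2) ^ (-(1 / mass μ₀ η (k + 1))) * Real.exp (2 * κ)) := by
        refine mul_le_mul hα ?_ (Real.exp_pos _).le (by positivity)
        calc Real.exp t ≤ Real.exp (τ k + 2 * κ) := Real.exp_le_exp.2 ht.2
          _ = Real.exp (τ k) * Real.exp (2 * κ) := Real.exp_add _ _
          _ ≤ _ := mul_le_mul_of_nonneg_right (hτexp k) (Real.exp_pos _).le
      _ = 1 / 24 * ((α k / 2) ^ (1 / mass μ₀ η (k + 1)) *
          (α k / 2) ^ (-(1 / mass μ₀ η (k + 1)))) * (Real.exp (-2 * κ) * Real.exp (2 * κ)) := by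
        ring
      _ = 1 / 24 := by rw [hinv, ← Real.exp_add]; simp
  -- These are the opposite pieces of index at most `k`. Transition zones are included: they start
  -- at least as far out as the core of their piece, and order is preserved.
  have hsettled : ∀ y ∈ side P (k + 1 + 1) \ ⋃ j, P (k + 2 + j),
      (-1) ^ (k + 1) * u y (τ k) ≤ -crit := by
    rintro y ⟨hy, hyt⟩
    obtain ⟨i, hi, hyi⟩ := exists_of_mem_side hy
    have hik : i ≤ k := by
      by_contra! hlt
      have : k + 2 ≤ i := by omega
      exact hyt (mem_iUnion.2 ⟨i - (k + 2), by rwa [Nat.add_sub_cancel' this]⟩)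
    have hsgn : (-1 : ℝ) ^ (k + 1) = -(-1) ^ i := by
      obtain ⟨d, rfl⟩ := Nat.exists_eq_add_of_le hik
      have hd : Even d := Nat.even_iff.2 (by omega)
      rw [pow_succ, pow_add, hd.neg_one_pow]; ring
    have h1 := (hf.sol.isTrajectory y).le_of_le (hf.sol.isTrajectory (r i)) (by
      have h2 := (h.bounds_on_P hyi).1
      have h3 := h.sign_core (hr i)
      rw [h.sign_start hm y, h.sign_start hm (r i), hsgn]
      linarith) (hτ0 k).le
    have h4 := hset i (τ k) (hτmono.monotone hik)
    simp only [hsgn] at h1 ⊢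
    linarith
  have hrest : ν.real (side P (k + 1 + 1) \ (side P (k + 1 + 1) \ ⋃ j, P (k + 2 + j))) ≤
      8 / 7 * mass μ₀ η (k + 1 + 1) := by
    refine (measureReal_mono ?_).trans (h.real_tail_le (k + 2))
    rw [Set.sdiff_sdiff_right_self]
    exact inter_subset_right
  obtain ⟨t, ht0, hor, ht⟩ := hf.exists_le_b (h.isPhase (k + 1) (hr (k + 1)) (hr (k + 1 + 1)))
    (O' := side P (k + 1 + 1) \ ⋃ j, P (k + 2 + j)) (hτ0 k).le
    ((h.measurableSet_side _).diff (MeasurableSet.iUnion fun _ => h.data.measurableSet_P _))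
    sdiff_subset hsettled hrest (hτmono (Nat.lt_succ_self k)).le rfl hgap hτ hclose
  refine ⟨t, ht0, ?_, ht⟩
  rcases hor with h1 | h1
  · simp only [hk, add_sub_cancel_right] at h1
    -- The tiny height forces a late time: `exp t ≥ 2μ exp(2κ) ≥ 2μ (18/μ)² = 648/μ` with `μ =
    -- μ_{k+2}`.
    have h2 : α (k + 1) ≤ Real.exp (-2 * κ) := by
      refine hα.trans (mul_le_of_le_one_left (Real.exp_pos _).le ?_)
      have := Real.rpow_le_one (half_pos hαk).le (by linarith [h.α_le_half k])
        (one_div_nonneg.2 (h.mass_pos (k + 1)).le)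
      linarith
    have h3 : 2 * mass μ₀ η (k + 2) * Real.exp (2 * κ) ≤ Real.exp t := by
      calc 2 * mass μ₀ η (k + 2) * Real.exp (2 * κ)
          ≤ Real.exp (-2 * κ) * Real.exp t * Real.exp (2 * κ) := by
            refine mul_le_mul_of_nonneg_right (h1.trans ?_) (Real.exp_pos _).le
            exact mul_le_mul_of_nonneg_right h2 (Real.exp_pos _).le
        _ = Real.exp t := by rw [mul_right_comm, ← Real.exp_add]; simp
    refine le_trans ?_ h3
    have h4 : Real.exp (2 * κ) = Real.exp κ * Real.exp κ := by rw [← Real.exp_add]; ring_nf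
    have h5 := mul_le_mul hκexp hκexp (by positivity) (Real.exp_pos κ).le
    rw [h4]
    calc 1 / mass μ₀ η (k + 2) ≤ 2 * mass μ₀ η (k + 2) *
          (18 / mass μ₀ η (k + 2) * (18 / mass μ₀ η (k + 2))) := by
          rw [show 2 * mass μ₀ η (k + 2) * (18 / mass μ₀ η (k + 2) * (18 / mass μ₀ η (k + 2)))
            = 648 / mass μ₀ η (k + 2) by field_simp; norm_num]
          gcongr; norm_num
      _ ≤ _ := by gcongr
  · calc 1 / mass μ₀ η (k + 2) ≤ 18 / mass μ₀ η (k + 2) := by gcongr; norm_num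
      _ ≤ Real.exp κ := hκexp
      _ ≤ Real.exp t := Real.exp_le_exp.2 h1

theorem eventually_mass_lt (h : IsSetting ν μ₀ η θ α L M R P Z v₀ u)
    {ε : ℝ} (hε : 0 < ε) : ∀ᶠ k in atTop, mass μ₀ η (k + 2) < ε := by
  have h1 : Tendsto (fun k : ℕ => mass μ₀ η k) atTop (𝓝 0) := by
    simpa [mass] using (tendsto_pow_atTop_nhds_zero_of_lt_one h.η_pos.le
      (by linarith [h.η_le])).const_mul μ₀
  exact ((tendsto_add_atTop_iff_nat 2).2 h1).eventually_lt_const hε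

end IsSetting
end Setting
end NonlocalODE

/-! ### Assembly of both claims -/

open NonlocalODE
theorem mainTheorem3 {X : Type*} [MeasurableSpace X] (ν : Measure X) [IsProbabilityMeasure ν]
    (μ₀ η θ : ℝ) (α : ℕ → ℝ) (L M R : Set X) (P Z : ℕ → Set X) (v₀ : X → ℝ)
    (hμ₀_pos : 0 < μ₀) (hμ₀ : μ₀ ≤ 1 / 10)
    (hη_pos : 0 < η) (hη : η ≤ 1 / 8)
    (hθ_nonneg : 0 ≤ θ) (hθ : θ ≤ η ^ 2)
    (hα_pos : ∀ j, 0 < α j) (hα_anti : Antitone α) (hα₀ : α 0 ≤ 1 / 2)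
    (hdata : IsPiecewiseData ν μ₀ η θ α L M R P Z v₀)
    -- the decay condition on the heights, for all indices `j + 1 ≥ 1`
    (hα : ∀ j : ℕ,
      α (j + 1) ≤ mass μ₀ η (j + 1) * (α j / 2) ^ (1 / mass μ₀ η (j + 1)))
    (u : X → ℝ → ℝ) (hu : IsSolution ν cubicForce u)
    (hu₀ : ∀ x, u x 0 = v₀ x - ∫ y, v₀ y ∂ν) :
    -- (i)
    (∃ (τm : EReal) (τ : ℕ → EReal),
      (∀ x ∈ M, IsTransitionTime (u x) τm) ∧
      (∀ j, ∀ x ∈ P j \ Z j, IsTransitionTime (u x) (τ j)) ∧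
      τm = ⊤ ∧
      (∀ j, τ j < τ (j + 1)) ∧
      (∀ j, τ j ≠ ⊤ ∧
        Real.exp (τ j).toReal ≤ (α j / 2) ^ (-(1 / mass μ₀ η (j + 1))))) ∧
    -- (ii)
    ((∀ᶠ j : ℕ in atTop,
        α (j + 1) ≤ 1 / 24 * (α j / 2) ^ (1 / mass μ₀ η (j + 1)) *
          Real.exp (-2 * kappa μ₀ η (j + 1))) →
      ∀ p : ENNReal, 1 ≤ p → p ≠ ⊤ →
        ¬ ∃ w : X → ℝ, MemLp w p ν ∧
          Tendsto (fun t : ℝ => eLpNorm (fun x => u x t - w x) p ν) atTop (𝓝 0)) := by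
  have h : IsSetting ν μ₀ η θ α L M R P Z v₀ u :=
    ⟨hμ₀_pos, hμ₀, hη_pos, hη, hθ_nonneg, hθ, hα_pos, hα_anti, hα₀, hdata, hα, hu, hu₀⟩
  obtain ⟨m, hm⟩ := h.M_nonempty
  choose r hr using h.core_nonempty
  choose a c L' R' τ hf hτ0 hτle hbefore hafter hτ hgap using h.exists_settling hm hr
  have hM : ∀ x ∈ M, ∀ t, 0 ≤ t → u x t = u m t := fun x hx t ht =>
    (hu.isTrajectory x).eq_of_eq (hu.isTrajectory m)
      (by rw [hu₀, hu₀, hdata.value_M x hx, hdata.value_M m hm]) ht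
  have hτmono : StrictMono τ := by
    refine strictMono_nat_of_lt_succ fun k => ?_
    -- At `τ k` the piece `k + 1` has not yet reached the critical point on its own side, whereas it
    -- stays beyond it from `τ (k + 1)` on.
    by_contra! hle
    have h1 := hafter (k + 1) (τ k) hle
    have h2 := (hgap k (τ k) ⟨(hτ0 k).le, le_rfl⟩).2.2
    rw [pow_succ] at h1
    linarith
  have hτexp : ∀ k, Real.exp (τ k) ≤ (α k / 2) ^ (-(1 / mass μ₀ η (k + 1))) := fun k => by
    rw [← exp_log_div (hα_pos k)]
    exact Real.exp_le_exp.2 (hτle k)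
  refine ⟨⟨⊤, fun j => (τ j : EReal), fun x hx => ⟨by simp,
    fun t ht => ⟨fun _ => ?_, fun htop => ?_⟩⟩,
    fun j x hx => ?_, rfl, fun j => EReal.coe_lt_coe (hτmono (Nat.lt_succ_self j)),
    fun j => ⟨EReal.coe_ne_top _, by simpa using hτexp j⟩⟩, fun hev p hp _ => ?_⟩
  · have h1 := (hf 0).neg_crit_lt_b ht
    have h2 := (hf 0).b_lt_crit ht
    simp only [pow_zero, one_mul] at h1 h2
    rw [hM x hx t ht]
    exact ⟨h1, h2⟩
  · exact absurd htop (not_le.2 (EReal.coe_lt_top t))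
  · have heq : ∀ t, 0 ≤ t → u x t = u (r j) t := fun t ht =>
      (hu.isTrajectory x).eq_of_eq (hu.isTrajectory (r j))
        (by rw [hu₀, hu₀, hdata.value_P j x hx, hdata.value_P j _ (hr j)]) ht
    refine isTransitionTime_of_sign (neg_one_pow_eq_or ℝ j) (hτ0 j) (fun t ht htτ => ?_)
      fun t ht => ?_
    · rw [heq t ht]
      exact ⟨((hf j).neg_crit_lt_b ht).trans ((hf j).b_lt (mem_side (hr j).1 rfl) ht),
        hbefore j t ht htτ⟩
    · have ht0 := (hτ0 j).le.trans ht
      rw [heq t ht0]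
      exact ⟨hafter j t ht, ((hf j).le_c (r j) ht0).trans ((hf j).bounds t ht0).2.le⟩
  · have hlate : ∀ A : ℝ, ∀ᶠ k : ℕ in atTop,
        ∃ t, 0 ≤ t ∧ A ≤ t ∧ 1 / 20 ≤ (-1) ^ (k + 1) * u m t := by
      intro A
      filter_upwards [hev, h.eventually_mass_lt (Real.exp_pos (-A))] with k hk hkA
      obtain ⟨t, ht0, ht, htb⟩ := h.exists_late hm hr hτ0 hτmono hτexp hafter (hf (k + 1))
        (hτ (k + 1)) (fun t ht => ⟨(hgap (k + 1) t ht).1, (hgap (k + 1) t ht).2.1⟩) hk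
      refine ⟨t, ht0, Real.exp_le_exp.1 (le_trans ?_ ht), htb⟩
      rw [le_div_iff₀ (h.mass_pos _)]
      calc Real.exp A * mass μ₀ η (k + 2) ≤ Real.exp A * Real.exp (-A) := by gcongr
        _ = 1 := by rw [← Real.exp_add]; simp
    refine not_tendsto_of_oscillation (b := u m) (δ := 1 / 20) (by norm_num)
      hdata.measurableSet_M ?_ hu.measurable hM (fun A => ?_) (fun A => ?_) hp
    · intro h0
      have := hdata.mass_M
      simp [Measure.real, h0] at this
    · obtain ⟨N, hN⟩ := eventually_atTop.1 (hlate A)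
      -- Phases of even index `k + 1` push M to the right, those of odd index to the left.
      obtain ⟨t, ht0, htA, ht⟩ := hN (2 * N + 1) (by omega)
      rw [show 2 * N + 1 + 1 = 2 * (N + 1) by ring, pow_mul] at ht
      exact ⟨t, ht0, htA, by simpa using ht⟩
    · obtain ⟨N, hN⟩ := eventually_atTop.1 (hlate A)
      obtain ⟨t, ht0, htA, ht⟩ := hN (2 * N) (by omega)
      rw [pow_succ, pow_mul] at ht
      exact ⟨t, ht0, htA, by norm_num at ht; linarith⟩
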